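/- Let $\Omega\subseteq\mathbb{R}^2$ be open, let $\boldsymbol{u}=(u,v):\Omega\to\mathbb{R}^2$ be twice continuously differentiable, and let $\boldsymbol{x}_0\in\Omega$ satisfy $\det D\boldsymbol{u}(\boldsymbol{x}_0)\neq 0$. For $\varrho>0$ let $D_\varrho(\boldsymbol{x}_0)$ be the closed Euclidean disc of radius $\varrho$ around $\boldsymbol{x}_0$, where $\varrho$ is so small that $D_\varrho(\boldsymbol{x}_0)\subset\Omega$. The *affine equivariant transformed $L^1$ median filter* with structuring element $D_\varrho$ assigns to $\boldsymbol{x}_0$ the value $\boldsymbol{u}^*_\varrho=D\boldsymbol{u}(\boldsymbol{x}_0)\,\hat{\boldsymbol{u}}^*$, where $\hat{\boldsymbol{u}}^*$ is the $L^1$ median of the transformed data, i.e. a minimiser over $\boldsymbol{y}\in\mathbb{R}^2$ of $$\int_{D_\varrho(\boldsymbol{x}_0)}\bigl\|\boldsymbol{y}-D\boldsymbol{u}(\boldsymbol{x}_0)^{-1}\boldsymbol{u}(\boldsymbol{x})\bigr\|\,\mathrm{d}\boldsymbol{x}.$$ The *Oja median filter* assigns to $\boldsymbol{x}_0$ a minimiser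 $\boldsymbol{o}_\varrho$ over $\boldsymbol{y}\in\mathbb{R}^2$ of $$\int_{D_\varrho(\boldsymbol{x}_0)}\int_{D_\varrho(\boldsymbol{x}_0)}\bigl|[\boldsymbol{y},\boldsymbol{u}(\boldsymbol{x}_1),\boldsymbol{u}(\boldsymbol{x}_2)]\bigr|\,\mathrm{d}\boldsymbol{x}_2\,\mathrm{d}\boldsymbol{x}_1,$$ where $|[\boldsymbol{a},\boldsymbol{b},\boldsymbol{c}]|$ is the area of the triangle with vertices $\boldsymbol{a},\boldsymbol{b},\boldsymbol{c}$. Let $\boldsymbol{F}(\boldsymbol{x}_0)$ be the value at $\boldsymbol{x}_0$ of the right-hand side of the PDE system $$\begin{pmatrix}u_t\\v_t\end{pmatrix}=2\begin{pmatrix}u_{xx}+u_{yy}\\v_{xx}+v_{yy}\end{pmatrix}-\boldsymbol{A}\begin{pmatrix}u_{xx}-u_{yy}\\v_{yy}-v_{xx}\end{pmatrix}-\boldsymbol{B}\begin{pmatrix}u_{xy}\\v_{xy}\end{pmatrix}$$ with $$\boldsymbol{A}=\frac{1}{u_xv_y-u_yv_x}\begin{pmatrix}u_xv_y+u_yv_x&2u_xu_y\\2v_xv_y&u_xv_y+u_yv_x\end{pmatrix},\qquad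 \boldsymbol{B}=\frac{2}{u_xv_y-u_yv_x}\begin{pmatrix}-u_xv_x+u_yv_y&u_x^2-u_y^2\\-v_x^2+v_y^2&u_xv_x-u_yv_y\end{pmatrix}.$$ Then, for all sufficiently small $\varrho>0$, the value $\boldsymbol{u}^*_\varrho$ exists and is unique, and as $\varrho\to0^+$ it approximates an explicit time step of size $\tau=\varrho^2/24$ of this PDE system: $$\boldsymbol{u}^*_\varrho=\boldsymbol{u}(\boldsymbol{x}_0)+\tfrac{\varrho^2}{24}\,\boldsymbol{F}(\boldsymbol{x}_0)+o(\varrho^2).$$ Likewise, Oja median filter values exist for all sufficiently small $\varrho>0$, and every choice $\boldsymbol{o}_\varrho$ of them satisfies $\boldsymbol{o}_\varrho=\boldsymbol{u}(\boldsymbol{x}_0)+\tfrac{\varrho^2}{24}\boldsymbol{F}(\boldsymbol{x}_0)+o(\varrho^2)$. Consequently the two filters are asymptotically equivalent: $\boldsymbol{u}^*_\varrho-\boldsymbol{o}_\varrho=o(\varrho^2)$ as $\varrho\to0^+$. -/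

import Mathlib

open MeasureTheory Filter Topology Asymptotics
open scoped Matrix

namespace BivariateMedian

noncomputable section

/-- The Euclidean plane, used both as image domain and as value domain. -/
abbrev Plane : Type := EuclideanSpace ℝ (Fin 2)

/-! ### Medians of continuous data sets

The data set is `{f x | x ∈ S}`, weighted with the density induced by the uniform distribution
of the argument `x` in `S`. Normalising that distribution only multiplies the objective
functions by a positive constant, so Lebesgue measure on `S` is used. The minimisers are
collected in a set, as `argmin` is set-valued in general. -/

/-- The `L¹` medians of the data `f x`, `x ∈ S`: the minimisers `m` of the integral of the
Euclidean distances `‖m - f x‖`. -/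
def l1Medians (S : Set Plane) (f : Plane → Plane) : Set Plane :=
  {m | IntegrableOn f S ∧
    ∀ y : Plane, ∫ x in S, ‖m - f x‖ ≤ ∫ x in S, ‖y - f x‖}

/-- The area of the triangle with vertices `a`, `b`, `c`. -/
def triangleArea (a b c : Plane) : ℝ :=
  |(b 0 - a 0) * (c 1 - a 1) - (b 1 - a 1) * (c 0 - a 0)| / 2

/-- The Oja (simplex) medians of the data `f x`, `x ∈ S`: the minimisers `m` of the integral
of the areas of all triangles formed by `m` and two data points. -/
def ojaMedians (S : Set Plane) (f : Plane → Plane) : Set Plane :=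
  {m | IntegrableOn f S ∧
    ∀ y : Plane, ∫ x₁ in S, ∫ x₂ in S, triangleArea m (f x₁) (f x₂) ≤
      ∫ x₁ in S, ∫ x₂ in S, triangleArea y (f x₁) (f x₂)}

/-! ### The two affine equivariant median filters

The structuring element at `x₀` is the disc of radius `ρ` around `x₀`. -/

/-- The possible values at `x₀` of the Oja median filtered image `u`. -/
def ojaMedianFilter (u : Plane → Plane) (x₀ : Plane) (ρ : ℝ) : Set Plane :=
  ojaMedians (Metric.closedBall x₀ ρ) u

/-- The possible values at `x₀` of the image `u` filtered by the affine equivariant transformed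
`L¹` median filter: transform the data by `Du(x₀)⁻¹`, take the `L¹` median, and transform
it back by `Du(x₀)`. Meaningful where `det Du(x₀) ≠ 0`. -/
def transformedL1MedianFilter (u : Plane → Plane) (x₀ : Plane) (ρ : ℝ) : Set Plane :=
  (fun m => fderiv ℝ u x₀ m) ''
    l1Medians (Metric.closedBall x₀ ρ) (fun x => (fderiv ℝ u x₀).inverse (u x))

/-! ### The PDE system -/

/-- The partial derivative of a scalar function with respect to the `i`-th coordinate. -/
def pd (i : Fin 2) (g : Plane → ℝ) : Plane → ℝ :=
  fun x => fderiv ℝ g x (EuclideanSpace.single i 1)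

/-- The coefficient matrix `A(Du)` as a function of the entries of `Du`. -/
def coeffA (ux uy vx vy : ℝ) : Matrix (Fin 2) (Fin 2) ℝ :=
  (1 / (ux * vy - uy * vx)) •
    !![ux * vy + uy * vx, 2 * ux * uy; 2 * vx * vy, ux * vy + uy * vx]

/-- The coefficient matrix `B(Du)` as a function of the entries of `Du`. -/
def coeffB (ux uy vx vy : ℝ) : Matrix (Fin 2) (Fin 2) ℝ :=
  (2 / (ux * vy - uy * vx)) •
    !![-ux * vx + uy * vy, ux ^ 2 - uy ^ 2; -vx ^ 2 + vy ^ 2, ux * vx - uy * vy]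

/-- The right-hand side at the point `x` of the evolution system `(uₜ, vₜ) = …`
for an image `f` with channels `u`, `v`. -/
def pdeRHS (f : Plane → Plane) (x : Plane) : Plane :=
  let u : Plane → ℝ := fun z => f z 0
  let v : Plane → ℝ := fun z => f z 1
  let A := coeffA (pd 0 u x) (pd 1 u x) (pd 0 v x) (pd 1 v x)
  let B := coeffB (pd 0 u x) (pd 1 u x) (pd 0 v x) (pd 1 v x)
  let uxx := pd 0 (pd 0 u) x
  let uxy := pd 1 (pd 0 u) x
  let uyy := pd 1 (pd 1 u) x
  let vxx := pd 0 (pd 0 v) x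
  let vxy := pd 1 (pd 0 v) x
  let vyy := pd 1 (pd 1 v) x
  WithLp.toLp 2
    ((2 : ℝ) • ![uxx + uyy, vxx + vyy] - A *ᵥ ![uxx - uyy, vyy - vxx] - B *ᵥ ![uxy, vxy])

/-! ### Approximation of a time step -/

/-- A (possibly set-valued) family `M ρ` of filter values approximates, for `ρ → 0`, an explicit
time step of size `τ ρ` with speed `F` from the value `a`: values exist for all small `ρ > 0`,
and every choice `m ρ ∈ M ρ` satisfies `m ρ = a + τ ρ • F + o(τ ρ)`. -/
def ApproximatesTimeStep (M : ℝ → Set Plane) (a : Plane) (τ : ℝ → ℝ) (F : Plane) : Prop :=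
  (∀ᶠ ρ in 𝓝[>] (0 : ℝ), (M ρ).Nonempty) ∧
    ∀ m : ℝ → Plane, (∀ᶠ ρ in 𝓝[>] (0 : ℝ), m ρ ∈ M ρ) →
      (fun ρ => m ρ - (a + τ ρ • F)) =o[𝓝[>] (0 : ℝ)] τ

end

end BivariateMedian

namespace BivariateMedian

/-! Both filters commute with linear maps of the values: the transformed `L¹` filter by
construction, the Oja filter because triangle areas scale by `|det|` (`ojaMedians_eq_image`). So `u`
may be replaced by `g = Du(x₀)⁻¹ u`, whose derivative at `x₀` is the identity. With `x = x₀ + ε z`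
the data become `g x₀ + ε (z + ε P z)`, where `P` tends uniformly on the unit disc to the quadratic
Taylor part `q` of `g` (`tendstoUniformlyOn_secondOrderPart`), and candidate medians are written `g
x₀ + ε² w`.

In each objective the zeroth order part does not involve `w`, and the part linear in `w` has
integral zero by oddness. Dividing what is left by `ε²` gives convex functions `l1Energy` and
`ojaEnergy` of `w`. Both converge to limits of the form `c + κ (‖w - w₀‖² - ‖w₀‖²)` with the same
`w₀ = medianShift X M Y`. Convexity turns this convergence into existence of minimisers and their
convergence to `w₀` (`eventually_exists_min_of_convexOn`).

For `L¹`, the second order term of `‖z + v‖` is `det2 z v ^ 2 / (2 ‖z‖³)`; the singularity at `z =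
0` is dominated by a multiple of `‖z‖⁻¹`, integrable in the plane. For Oja, the absolute value of a
determinant deviates from its linearisation only where the determinant changes sign, that is, for
nearly collinear pairs. Blowing up this layer by `1 / ε` across the direction of the first point and
using `∫ absRem r c dr = c²` yields the limit. In both cases the radial integration leaves the same
combination `β² - (2/3) α β`, with `α = det2 (radial θ) (q (radial θ))` and `β = det2 (radial θ) w`,
which `integral_det2_radial` integrates over the angle. Mapping `w₀` back by `Du(x₀)` gives `pdeRHS
/ 24`, a rational identity in the entries of `Du` (`map_medianShift_eq_pdeRHS`).

Uniqueness of the `L¹` median is strict convexity: two medians would force `g` to take values in a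
line near `x₀`, contradicting `Dg(x₀) = id`. -/

/-! ### Plane geometry and integration in polar and rotated coordinates. -/

/-- The unit vector with polar angle `θ`. -/
noncomputable def radial (θ : ℝ) : Plane := !₂[Real.cos θ, Real.sin θ]

/-- The unit vector orthogonal to `radial θ`. -/
noncomputable def angular (θ : ℝ) : Plane := !₂[-Real.sin θ, Real.cos θ]

/-- The determinant of two plane vectors. -/
def det2 (a b : Plane) : ℝ := a 0 * b 1 - a 1 * b 0

@[simp] lemma radial_zero (θ : ℝ) : radial θ 0 = Real.cos θ := rfl
@[simp] lemma radial_one (θ : ℝ) : radial θ 1 = Real.sin θ := rfl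
@[simp] lemma angular_zero (θ : ℝ) : angular θ 0 = -Real.sin θ := rfl
@[simp] lemma angular_one (θ : ℝ) : angular θ 1 = Real.cos θ := rfl

lemma Plane.norm_sq (z : Plane) : ‖z‖ ^ 2 = z 0 ^ 2 + z 1 ^ 2 := by
  rw [EuclideanSpace.norm_sq_eq]; simp

@[simp] lemma norm_radial (θ : ℝ) : ‖radial θ‖ = 1 := by
  have h := Plane.norm_sq (radial θ)
  simp only [radial_zero, radial_one, Real.cos_sq_add_sin_sq] at h
  nlinarith [norm_nonneg (radial θ)]

lemma abs_det2_le (a b : Plane) : |det2 a b| ≤ ‖a‖ * ‖b‖ := by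
  refine abs_le_of_sq_le_sq ?_ (by positivity)
  rw [mul_pow, Plane.norm_sq, Plane.norm_sq, det2]
  nlinarith [sq_nonneg (a 0 * b 0 + a 1 * b 1)]

lemma measurePreserving_plane :
    MeasurePreserving (fun p : ℝ × ℝ => (!₂[p.1, p.2] : Plane)) :=
  (PiLp.volume_preserving_toLp (Fin 2)).comp
    ((volume_preserving_finTwoArrow ℝ).symm MeasurableEquiv.finTwoArrow)

lemma measurableEmbedding_plane :
    MeasurableEmbedding (fun p : ℝ × ℝ => (!₂[p.1, p.2] : Plane)) :=
  (MeasurableEquiv.toLp 2 (Fin 2 → ℝ)).measurableEmbedding.comp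
    (MeasurableEquiv.finTwoArrow (α := ℝ)).symm.measurableEmbedding

lemma integral_plane (h : Plane → ℝ) : ∫ z, h z = ∫ p : ℝ × ℝ, h !₂[p.1, p.2] :=
  (measurePreserving_plane.integral_comp measurableEmbedding_plane h).symm

lemma integral_plane_polar (h : Plane → ℝ) :
    ∫ z, h z = ∫ p in Set.Ioi (0 : ℝ) ×ˢ Set.Ioo (-Real.pi) Real.pi,
      p.1 * h (p.1 • radial p.2) := by
  rw [integral_plane, ← integral_comp_polarCoord_symm, polarCoord_target]
  refine integral_congr_ae (Eventually.of_forall fun p => ?_)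
  simp only [polarCoord_symm_apply, smul_eq_mul]
  congr 2
  ext i
  fin_cases i <;> simp [radial]

lemma setIntegral_disc_polar (h : Plane → ℝ) :
    ∫ z in Metric.closedBall (0 : Plane) 1, h z =
      ∫ p in Set.Ioc (0 : ℝ) 1 ×ˢ Set.Ioo (-Real.pi) Real.pi, p.1 * h (p.1 • radial p.2) := by
  rw [← integral_indicator Metric.isClosed_closedBall.measurableSet, integral_plane_polar,
    ← integral_indicator (measurableSet_Ioi.prod measurableSet_Ioo),
    ← integral_indicator (measurableSet_Ioc.prod measurableSet_Ioo)]
  refine integral_congr_ae (Eventually.of_forall fun p => ?_)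
  by_cases h1 : p ∈ Set.Ioi (0 : ℝ) ×ˢ Set.Ioo (-Real.pi) Real.pi
  · have h0 : 0 < p.1 := h1.1
    by_cases h2 : p.1 ≤ 1
    · have h3 : p ∈ Set.Ioc (0 : ℝ) 1 ×ˢ Set.Ioo (-Real.pi) Real.pi := ⟨⟨h0, h2⟩, h1.2⟩
      have h4 : p.1 • radial p.2 ∈ Metric.closedBall (0 : Plane) 1 := by
        simp [norm_smul, abs_of_pos h0, h2]
      simp only [Set.indicator_of_mem h1, Set.indicator_of_mem h3, Set.indicator_of_mem h4]
    · have h3 : p ∉ Set.Ioc (0 : ℝ) 1 ×ˢ Set.Ioo (-Real.pi) Real.pi := fun h => h2 h.1.2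
      have h4 : p.1 • radial p.2 ∉ Metric.closedBall (0 : Plane) 1 := by
        simp [norm_smul, abs_of_pos h0, not_le.1 h2]
      simp only [Set.indicator_of_mem h1, Set.indicator_of_notMem h3, Set.indicator_of_notMem h4,
        mul_zero]
  · have h3 : p ∉ Set.Ioc (0 : ℝ) 1 ×ˢ Set.Ioo (-Real.pi) Real.pi :=
      fun h => h1 ⟨h.1.1, h.2⟩
    simp only [Set.indicator_of_notMem h1, Set.indicator_of_notMem h3]

/-- Integration over the plane in coordinates along `radial θ` and `angular θ`,
the second one stretched by `c`. -/
lemma integral_plane_frame (h : Plane → ℝ) (θ : ℝ) {c : ℝ} (hc : 0 < c) :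
    ∫ z, h z = c * ∫ p : ℝ × ℝ, h (p.1 • radial θ + (c * p.2) • angular θ) := by
  let M : Matrix (Fin 2) (Fin 2) ℝ := !![Real.cos θ, -(c * Real.sin θ); Real.sin θ, c * Real.cos θ]
  let T : ℝ × ℝ →ₗ[ℝ] ℝ × ℝ := Matrix.toLin (Module.Basis.finTwoProd ℝ) (Module.Basis.finTwoProd ℝ) M
  have hdet : LinearMap.det T = c := by
    rw [LinearMap.det_toLin, Matrix.det_fin_two]
    simp only [M, Matrix.of_apply, Matrix.cons_val', Matrix.cons_val_zero, Matrix.cons_val_one,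
      Matrix.cons_val_fin_one]
    linear_combination c * Real.sin_sq_add_cos_sq θ
  have hdet0 : LinearMap.det T ≠ 0 := by rw [hdet]; exact hc.ne'
  have hT : ∀ p, T p = (Real.cos θ * p.1 + -(c * Real.sin θ) * p.2,
      Real.sin θ * p.1 + c * Real.cos θ * p.2) := fun p => by
    simp [T, M, Matrix.toLin_finTwoProd_apply]
  have hemb : MeasurableEmbedding T :=
    ((T.equivOfDetNeZero hdet0).toContinuousLinearEquiv.toHomeomorph).measurableEmbedding
  have h1 := hemb.integral_map (μ := volume) (fun p : ℝ × ℝ => h !₂[p.1, p.2])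
  rw [Measure.map_linearMap_addHaar_eq_smul_addHaar _ hdet0, hdet, integral_smul_measure,
    abs_of_pos (inv_pos.2 hc), ENNReal.toReal_ofReal (inv_pos.2 hc).le, ← integral_plane] at h1
  have h2 : ∫ p : ℝ × ℝ, h (p.1 • radial θ + (c * p.2) • angular θ) = c⁻¹ • ∫ z, h z := by
    rw [h1]
    refine integral_congr_ae (Eventually.of_forall fun p => ?_)
    simp only [hT]
    congr 1
    ext i
    fin_cases i <;> simp <;> ring
  rw [h2, smul_eq_mul, mul_inv_cancel_left₀ hc.ne']

/-! ### Stability of minimisers of convex functions. -/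

/-- If a family of convex functions converges continuously to a function with a strict global
minimum at `w₀`, then minimisers eventually exist and lie close to `w₀`. -/
theorem eventually_exists_min_of_convexOn {ι E : Type*} [NormedAddCommGroup E] [NormedSpace ℝ E]
    [FiniteDimensional ℝ E] {l : Filter ι} {Φ : ι → E → ℝ} {Φ₀ : E → ℝ} {w₀ : E}
    (hconv : ∀ᶠ i in l, ConvexOn ℝ Set.univ (Φ i))
    (hlim : ∀ w, Tendsto (fun p : ι × E => Φ p.1 p.2) (l ×ˢ 𝓝 w) (𝓝 (Φ₀ w)))
    (hmin : ∀ w, w ≠ w₀ → Φ₀ w₀ < Φ₀ w) {δ : ℝ} (hδ : 0 < δ) :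
    ∀ᶠ i in l, (∃ w, ∀ y, Φ i w ≤ Φ i y) ∧ ∀ w, (∀ y, Φ i w ≤ Φ i y) → ‖w - w₀‖ < δ := by
  have : ProperSpace E := FiniteDimensional.proper ℝ E
  -- Joint convergence in `(i, w)` gives the inequality near each point of the sphere; compactness
  -- makes the set of indices uniform in `w`.
  have hsph : ∀ᶠ i in l, ∀ w ∈ Metric.sphere w₀ δ, Φ i w₀ < Φ i w := by
    have h0 : Tendsto (fun i => Φ i w₀) l (𝓝 (Φ₀ w₀)) :=
      (hlim w₀).comp (tendsto_id.prodMk tendsto_const_nhds)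
    have h1 : {p : ι × E | Φ p.1 w₀ < Φ p.1 p.2} ∈ l ×ˢ 𝓝ˢ (Metric.sphere w₀ δ) := by
      refine (isCompact_sphere w₀ δ).mem_prod_nhdsSet_of_forall fun w hw => ?_
      have hne : w ≠ w₀ := fun h => by
        rw [h, Metric.mem_sphere, dist_self] at hw
        exact hδ.ne hw
      exact (h0.comp tendsto_fst).eventually_lt (hlim w) (hmin w hne)
    obtain ⟨s, hs, t, ht, hst⟩ := mem_prod_iff.1 h1
    filter_upwards [hs] with i hi w hw
    exact hst (⟨hi, subset_of_mem_nhdsSet ht hw⟩ : (i, w) ∈ s ×ˢ t)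
  filter_upwards [hconv, hsph] with i hc hs
  -- The segment from `w₀` to `w` crosses the sphere, where the value exceeds `Φ i w₀`; by convexity
  -- the value at `w` must exceed it too.
  have hout : ∀ w, δ ≤ ‖w - w₀‖ → Φ i w₀ < Φ i w := by
    intro w hw
    have hpos : 0 < ‖w - w₀‖ := hδ.trans_le hw
    set t := δ / ‖w - w₀‖ with ht
    have ht0 : 0 < t := div_pos hδ hpos
    have ht1 : t ≤ 1 := (div_le_one hpos).2 hw
    have hmem : (1 - t) • w₀ + t • w ∈ Metric.sphere w₀ δ := by
      rw [mem_sphere_iff_norm]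
      have : (1 - t) • w₀ + t • w - w₀ = t • (w - w₀) := by module
      rw [this, norm_smul, Real.norm_of_nonneg ht0.le, ht, div_mul_cancel₀ _ hpos.ne']
    have h1 := hs _ hmem
    have h2 := hc.2 (Set.mem_univ w₀) (Set.mem_univ w) (sub_nonneg.2 ht1) ht0.le
      (sub_add_cancel 1 t)
    simp only [smul_eq_mul] at h2
    nlinarith
  refine ⟨?_, fun w hw => ?_⟩
  · obtain ⟨w, -, hw⟩ := (isCompact_closedBall w₀ δ).exists_isMinOn
      ⟨w₀, Metric.mem_closedBall_self hδ.le⟩ hc.locallyLipschitz.continuous.continuousOn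
    refine ⟨w, fun y => ?_⟩
    by_cases hy : y ∈ Metric.closedBall w₀ δ
    · exact hw hy
    · rw [mem_closedBall_iff_norm, not_le] at hy
      exact (hw (Metric.mem_closedBall_self hδ.le) : Φ i w ≤ Φ i w₀).trans (hout y hy.le).le
  · by_contra! h
    exact absurd (hw w₀) (not_le.2 (hout w h))

/-! ### Angular moments -/

lemma integral_cos_sin_quartic (a b d e f : ℝ) :
    ∫ θ in (-Real.pi)..Real.pi, (a * Real.cos θ ^ 4 + b * (Real.sin θ * Real.cos θ ^ 3)
      + d * (Real.sin θ ^ 2 * Real.cos θ ^ 2) + e * (Real.sin θ ^ 3 * Real.cos θ)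
      + f * Real.sin θ ^ 4) = Real.pi / 4 * (3 * a + d + 3 * f) := by
  have h1 : ∫ θ in (-Real.pi)..Real.pi, Real.cos θ ^ 4 = 3 * Real.pi / 4 := by
    rw [integral_cos_pow 2, integral_cos_sq]; simp; ring
  have h2 : ∫ θ in (-Real.pi)..Real.pi, Real.sin θ * Real.cos θ ^ 3 = 0 := by
    simpa using integral_sin_pow_odd_mul_cos_pow (a := -Real.pi) (b := Real.pi) 0 3
  have h3 : ∫ θ in (-Real.pi)..Real.pi, Real.sin θ ^ 2 * Real.cos θ ^ 2 = Real.pi / 4 := by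
    have h4 : Real.sin (4 * Real.pi) = 0 := by exact_mod_cast Real.sin_nat_mul_pi 4
    rw [integral_sin_sq_mul_cos_sq, mul_neg, Real.sin_neg, h4]; ring
  have h4 : ∫ θ in (-Real.pi)..Real.pi, Real.sin θ ^ 3 * Real.cos θ = 0 := by
    simpa using integral_sin_pow_odd_mul_cos_pow (a := -Real.pi) (b := Real.pi) 1 1
  have h5 : ∫ θ in (-Real.pi)..Real.pi, Real.sin θ ^ 4 = 3 * Real.pi / 4 := by
    rw [integral_sin_pow 2, integral_sin_sq]; simp; ring
  have hi : ∀ g : ℝ → ℝ, Continuous g → IntervalIntegrable g volume (-Real.pi) Real.pi :=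
    fun g hg => hg.intervalIntegrable _ _
  rw [intervalIntegral.integral_add (hi _ (by fun_prop)) (hi _ (by fun_prop)),
    intervalIntegral.integral_add (hi _ (by fun_prop)) (hi _ (by fun_prop)),
    intervalIntegral.integral_add (hi _ (by fun_prop)) (hi _ (by fun_prop)),
    intervalIntegral.integral_add (hi _ (by fun_prop)) (hi _ (by fun_prop))]
  simp only [intervalIntegral.integral_const_mul, h1, h2, h3, h4, h5]
  ring

/-- The quadratic map with second derivatives `X = ∂₀∂₀`, `M = ∂₀∂₁`, `Y = ∂₁∂₁`. -/
noncomputable def quadMap (X M Y z : Plane) : Plane :=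
  (1 / 2 : ℝ) • (z 0 ^ 2 • X + (2 * (z 0 * z 1)) • M + z 1 ^ 2 • Y)

/-- The limit displacement of the medians of the data `z + ε • quadMap X M Y z`. -/
noncomputable def medianShift (X M Y : Plane) : Plane :=
  (1 / 24 : ℝ) • !₂[X 0 + 3 * Y 0 - 2 * M 1, 3 * X 1 + Y 1 - 2 * M 0]

lemma quadMap_apply (X M Y z : Plane) (i : Fin 2) :
    quadMap X M Y z i = (z 0 ^ 2 * X i + 2 * (z 0 * z 1) * M i + z 1 ^ 2 * Y i) / 2 := by
  simp [quadMap]; ring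

lemma continuous_quadMap (X M Y : Plane) : Continuous (quadMap X M Y) := by
  unfold quadMap; fun_prop

lemma quadMap_smul (X M Y : Plane) (t : ℝ) (z : Plane) :
    quadMap X M Y (t • z) = t ^ 2 • quadMap X M Y z := by
  ext i
  simp only [quadMap_apply, PiLp.smul_apply, smul_eq_mul]
  ring

/-- Both limit functionals reduce to this angular integral, with weights `1 / 2` and `4 / 3`.
Completing the square in `w` is what produces `medianShift`. -/
lemma integral_det2_radial (X M Y w : Plane) :
    ∫ θ in (-Real.pi)..Real.pi, (det2 (radial θ) w ^ 2
        - 2 / 3 * (det2 (radial θ) (quadMap X M Y (radial θ)) * det2 (radial θ) w)) =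
      Real.pi * (‖w - medianShift X M Y‖ ^ 2 - ‖medianShift X M Y‖ ^ 2) := by
  have h : ∀ θ : ℝ, det2 (radial θ) w ^ 2
      - 2 / 3 * (det2 (radial θ) (quadMap X M Y (radial θ)) * det2 (radial θ) w) =
      (w 1 ^ 2 - 1 / 3 * (X 1 * w 1)) * Real.cos θ ^ 4
      + (-2 * w 0 * w 1 - 1 / 3 * ((2 * M 1 - X 0) * w 1 - X 1 * w 0))
        * (Real.sin θ * Real.cos θ ^ 3)
      + (w 0 ^ 2 + w 1 ^ 2 - 1 / 3 * ((Y 1 - 2 * M 0) * w 1 - (2 * M 1 - X 0) * w 0))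
        * (Real.sin θ ^ 2 * Real.cos θ ^ 2)
      + (-2 * w 0 * w 1 - 1 / 3 * (-Y 0 * w 1 - (Y 1 - 2 * M 0) * w 0))
        * (Real.sin θ ^ 3 * Real.cos θ)
      + (w 0 ^ 2 - 1 / 3 * (Y 0 * w 0)) * Real.sin θ ^ 4 := by
    intro θ
    simp only [det2, quadMap_apply, radial_zero, radial_one]
    -- The square `det2 (radial θ) w ^ 2` is only quadratic in `cos θ`, `sin θ`; multiplying it by
    -- `sin² + cos²` makes every term quartic.
    linear_combination (-(Real.cos θ * w 1 - Real.sin θ * w 0) ^ 2) * Real.sin_sq_add_cos_sq θ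
  simp only [h]
  rw [integral_cos_sin_quartic, Plane.norm_sq, Plane.norm_sq]
  simp only [medianShift, PiLp.sub_apply, PiLp.smul_apply, smul_eq_mul, Matrix.cons_val_zero,
    Matrix.cons_val_one]
  ring

/-! ### Second order expansion of the norm and the limit of the `L¹` energy. -/

/-- The closed unit disc. -/
abbrev disc : Set Plane := Metric.closedBall 0 1

lemma Plane.inner_eq (a b : Plane) : inner ℝ a b = a 0 * b 0 + a 1 * b 1 := by
  simp [PiLp.inner_apply, Fin.sum_univ_two, mul_comm]

/-- The remainder of the first order expansion of the norm at `z`. -/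
noncomputable def normRem (z v : Plane) : ℝ := ‖z + v‖ - ‖z‖ - inner ℝ v z / ‖z‖

lemma Plane.norm_add_sq (z v : Plane) : ‖z + v‖ ^ 2 = ‖z‖ ^ 2 + 2 * inner ℝ v z + ‖v‖ ^ 2 := by
  rw [norm_add_sq_real, real_inner_comm]

lemma normRem_mul_norm {z : Plane} (hz : z ≠ 0) (v : Plane) :
    normRem z v * ‖z‖ = ‖z‖ * ‖z + v‖ - (‖z‖ ^ 2 + inner ℝ v z) := by
  have := norm_ne_zero_iff.2 hz
  rw [normRem]; field_simp; ring

lemma normRem_nonneg (z v : Plane) : 0 ≤ normRem z v := by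
  rcases eq_or_ne z 0 with rfl | hz
  · simp [normRem]
  have hn : 0 < ‖z‖ := norm_pos_iff.2 hz
  have h := normRem_mul_norm hz v
  have h1 := real_inner_le_norm (z + v) z
  rw [inner_add_left, real_inner_self_eq_norm_sq] at h1
  have : 0 ≤ normRem z v * ‖z‖ := by rw [h]; nlinarith
  exact nonneg_of_mul_nonneg_left this hn

/-- No smallness of `v` relative to `z` is assumed, so the bound covers the singularity at `z = 0`
and supplies the dominating function for the `L¹` energy. -/
lemma normRem_le {z : Plane} (hz : z ≠ 0) (v : Plane) : normRem z v ≤ 2 * ‖v‖ ^ 2 * ‖z‖⁻¹ := by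
  have hn : 0 < ‖z‖ := norm_pos_iff.2 hz
  rw [← div_eq_mul_inv, le_div_iff₀ hn, normRem_mul_norm hz, sub_le_iff_le_add]
  have hp := abs_le.1 (abs_real_inner_le_norm v z)
  have hS := Plane.norm_add_sq z v
  set m := ‖v‖
  set n := ‖z‖
  set p : ℝ := inner ℝ v z
  have hm : 0 ≤ m := norm_nonneg v
  have hmn : 0 ≤ m * n := by positivity
  refine abs_le_of_sq_le_sq' ?_ ?_ |>.2
  · rw [mul_pow, hS]
    have h1 : -(m * n) * m ^ 2 ≤ p * m ^ 2 := mul_le_mul_of_nonneg_right hp.1 (sq_nonneg m)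
    nlinarith [mul_nonneg (sq_nonneg m) (sq_nonneg (m - n)), sq_nonneg p, sq_nonneg (m * n)]
  · nlinarith [sq_nonneg (m - n), sq_nonneg m, sq_nonneg n]

lemma det2_smul_right (t : ℝ) (a b : Plane) : det2 a (t • b) = t * det2 a b := by
  simp [det2]; ring

lemma det2_smul_left (t : ℝ) (a b : Plane) : det2 (t • a) b = t * det2 a b := by
  simp [det2]; ring

lemma continuous_det2 : Continuous fun p : Plane × Plane => det2 p.1 p.2 := by
  unfold det2; fun_prop

/-- Rationalising the difference of square roots, `normRem z v * ‖z‖` is the quotient of `‖z‖² ‖v‖²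
- ⟨v, z⟩²` by `‖z‖ ‖z + v‖ + ‖z‖² + ⟨v, z⟩`. The numerator is `det2 z v ^ 2` by Lagrange's identity.
-/
lemma tendsto_normRem_div {ι : Type*} {l : Filter ι} {ε : ι → ℝ} {a : ι → Plane} {a₀ z : Plane}
    (hz : z ≠ 0) (hε : Tendsto ε l (𝓝 0)) (hε0 : ∀ᶠ i in l, ε i ≠ 0) (ha : Tendsto a l (𝓝 a₀)) :
    Tendsto (fun i => normRem z (ε i • a i) / ε i ^ 2) l
      (𝓝 (det2 z a₀ ^ 2 / (2 * ‖z‖ ^ 3))) := by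
  have hn : 0 < ‖z‖ := norm_pos_iff.2 hz
  have hv : Tendsto (fun i => ε i • a i) l (𝓝 0) := by simpa using hε.smul ha
  have hden : Tendsto (fun i => ‖z‖ * (‖z‖ * ‖z + ε i • a i‖ + (‖z‖ ^ 2 + inner ℝ (ε i • a i) z))) l
      (𝓝 (2 * ‖z‖ ^ 3)) := by
    have hc : Continuous fun v : Plane => ‖z‖ * (‖z‖ * ‖z + v‖ + (‖z‖ ^ 2 + inner ℝ v z)) := by
      fun_prop
    have := (hc.tendsto 0).comp hv
    simp only [add_zero, inner_zero_left] at this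
    rw [show 2 * ‖z‖ ^ 3 = ‖z‖ * (‖z‖ * ‖z‖ + ‖z‖ ^ 2) by ring]
    exact this
  have hnum : Tendsto (fun i => det2 z (a i) ^ 2) l (𝓝 (det2 z a₀ ^ 2)) :=
    (((continuous_det2.tendsto (z, a₀)).comp (tendsto_const_nhds.prodMk_nhds ha))).pow 2
  have hpos : (0 : ℝ) < 2 * ‖z‖ ^ 3 := by positivity
  refine (hnum.div hden hpos.ne').congr' ?_
  filter_upwards [hε0, hden.eventually_ne hpos.ne'] with i hi hne
  have h1 := normRem_mul_norm hz (ε i • a i)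
  have h2 := Plane.norm_add_sq z (ε i • a i)
  have h3 : ‖z‖ ^ 2 * ‖ε i • a i‖ ^ 2 - (inner ℝ (ε i • a i) z) ^ 2 = ε i ^ 2 * det2 z (a i) ^ 2 := by
    rw [Plane.norm_sq, Plane.norm_sq, Plane.inner_eq, det2]
    simp; ring
  simp only [Pi.div_apply]
  rw [div_eq_div_iff hne (pow_ne_zero 2 hi)]
  set S := ‖z + ε i • a i‖
  set p : ℝ := inner ℝ (ε i • a i) z
  linear_combination (-1) * h3 - ‖z‖ ^ 2 * h2 - (‖z‖ * S + (‖z‖ ^ 2 + p)) * h1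

lemma integrableOn_inv_norm : IntegrableOn (fun z : Plane => ‖z‖⁻¹) disc := by
  have h : Integrable fun z : Plane => (Set.Iic (1 : ℝ)).indicator (fun y : ℝ => y⁻¹) ‖z‖ := by
    rw [integrable_fun_norm_addHaar]
    have h1 : IntegrableOn (Set.indicator (Set.Iic (1 : ℝ)) fun _ => (1 : ℝ)) (Set.Ioi 0) := by
      rw [integrableOn_indicator_iff measurableSet_Iic, Set.inter_comm, Set.Ioi_inter_Iic]
      exact integrableOn_const (by simp)
    refine h1.congr_fun (fun y hy => ?_) measurableSet_Ioi
    have hy0 : y ≠ 0 := (Set.mem_Ioi.1 hy).ne'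
    by_cases hy1 : y ∈ Set.Iic (1 : ℝ)
    · simp [Set.indicator_of_mem hy1, hy0]
    · simp [Set.indicator_of_notMem hy1]
  refine h.integrableOn.congr_fun (s := disc) (fun z hz => ?_)
    Metric.isClosed_closedBall.measurableSet
  exact Set.indicator_of_mem (by simpa using hz) _

lemma measurableSet_disc : MeasurableSet disc := Metric.isClosed_closedBall.measurableSet

instance : IsFiniteMeasure (volume.restrict disc) :=
  ⟨by simp⟩

lemma integrableOn_disc_of_bound {h : Plane → ℝ} (hm : Measurable h) {C : ℝ}
    (hC : ∀ z ∈ disc, |h z| ≤ C) : IntegrableOn h disc :=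
  Integrable.of_bound hm.aestronglyMeasurable C
    ((ae_restrict_iff' measurableSet_disc).2 (Eventually.of_forall hC))

lemma setIntegral_disc_eq_zero_of_odd {h : Plane → ℝ} (hh : ∀ z, h (-z) = -h z) :
    ∫ z in disc, h z = 0 := by
  have h1 : ∫ z in disc, h z = ∫ z in disc, h (-z) := by
    rw [← integral_indicator measurableSet_disc, ← integral_indicator measurableSet_disc,
      ← integral_neg_eq_self]
    refine integral_congr_ae (Eventually.of_forall fun z => ?_)
    have : -z ∈ disc ↔ z ∈ disc := by simp
    by_cases hz : z ∈ disc
    · simp only [Set.indicator_of_mem hz, Set.indicator_of_mem (this.2 hz)]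
    · simp only [Set.indicator_of_notMem hz, Set.indicator_of_notMem (fun h => hz (this.1 h))]
  simp only [hh, integral_neg] at h1
  linarith

/-- The rescaled and recentred `L¹` median objective for the data `z + ε • P z`, `z ∈ disc`. -/
noncomputable def l1Energy (ε : ℝ) (P : Plane → Plane) (w : Plane) : ℝ :=
  ∫ z in disc, normRem z (ε • (P z - w)) / ε ^ 2

/-- All dependence on `w` sits in the energy, since the first order term `ε ⟨w, z⟩ / ‖z‖` is odd in
`z`. -/
lemma integral_norm_eq_l1Energy {ε : ℝ} (hε : 0 < ε) {P : Plane → Plane} (hP : Measurable P)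
    {C : ℝ} (hC : ∀ z ∈ disc, ‖P z‖ ≤ C) (w : Plane) :
    ∫ z in disc, ‖z + ε • (P z - w)‖ =
      (∫ z in disc, (‖z‖ + ε * (inner ℝ (P z) z / ‖z‖))) + ε ^ 2 * l1Energy ε P w := by
  have hz1 : ∀ z ∈ disc, ‖z‖ ≤ 1 := fun z hz => by simpa using hz
  have hinner : ∀ a z : Plane, |inner ℝ a z / ‖z‖| ≤ ‖a‖ := fun a z => by
    rw [abs_div, abs_norm]
    exact div_le_of_le_mul₀ (norm_nonneg _) (norm_nonneg _) (abs_real_inner_le_norm a z)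
  have i1 : IntegrableOn (fun z => ‖z + ε • (P z - w)‖) disc := by
    refine integrableOn_disc_of_bound (by fun_prop) (C := 1 + ε * (C + ‖w‖)) fun z hz => ?_
    rw [abs_norm]
    refine (norm_add_le _ _).trans (add_le_add (hz1 z hz) ?_)
    rw [norm_smul, Real.norm_of_nonneg hε.le]
    gcongr
    exact (norm_sub_le _ _).trans (by gcongr; exact hC z hz)
  have i2 : IntegrableOn (fun z : Plane => ‖z‖ + ε * (inner ℝ (P z) z / ‖z‖)) disc := by
    refine integrableOn_disc_of_bound (by fun_prop) (C := 1 + ε * C) fun z hz => ?_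
    refine (abs_add_le _ _).trans (add_le_add (by simpa using hz1 z hz) ?_)
    rw [abs_mul, abs_of_pos hε]
    gcongr
    exact (hinner _ _).trans (hC z hz)
  have i3 : IntegrableOn (fun z : Plane => ε * (inner ℝ w z / ‖z‖)) disc := by
    refine integrableOn_disc_of_bound (by fun_prop) (C := ε * ‖w‖) fun z hz => ?_
    rw [abs_mul, abs_of_pos hε]
    gcongr
    exact hinner _ _
  have hodd : ∫ z in disc, ε * (inner ℝ w z / ‖z‖) = 0 :=
    setIntegral_disc_eq_zero_of_odd fun z => by simp [inner_neg_right, neg_div]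
  have hE : ε ^ 2 * l1Energy ε P w = ∫ z in disc, (‖z + ε • (P z - w)‖
      - (‖z‖ + ε * (inner ℝ (P z) z / ‖z‖)) + ε * (inner ℝ w z / ‖z‖)) := by
    rw [l1Energy, ← integral_const_mul]
    refine integral_congr_ae (Eventually.of_forall fun z => ?_)
    simp only
    rw [mul_div_cancel₀ _ (pow_ne_zero 2 hε.ne'), normRem, real_inner_smul_left, inner_sub_left]
    ring
  have h1 := integral_add (i1.sub i2) i3
  simp only [Pi.sub_apply] at h1
  rw [hE, h1, integral_sub i1 i2, hodd]
  ring

/-- The energy inherits convexity from the integral of norms, from which it differs by a constant in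
`w` and a positive factor. -/
lemma convexOn_l1Energy {ε : ℝ} (hε : 0 < ε) {P : Plane → Plane} (hP : Measurable P)
    {C : ℝ} (hC : ∀ z ∈ disc, ‖P z‖ ≤ C) : ConvexOn ℝ Set.univ (l1Energy ε P) := by
  have hint : ∀ w, IntegrableOn (fun z => ‖z + ε • (P z - w)‖) disc := fun w => by
    refine integrableOn_disc_of_bound (by fun_prop) (C := 1 + ε * (C + ‖w‖)) fun z hz => ?_
    rw [abs_norm]
    refine (norm_add_le _ _).trans (add_le_add (by simpa using hz) ?_)
    rw [norm_smul, Real.norm_of_nonneg hε.le]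
    gcongr
    exact (norm_sub_le _ _).trans (by gcongr; exact hC z hz)
  refine ⟨convex_univ, fun x _ y _ a b ha hb hab => ?_⟩
  have h := fun w => integral_norm_eq_l1Energy hε hP hC w
  have key : ∫ z in disc, ‖z + ε • (P z - (a • x + b • y))‖ ≤
      a * (∫ z in disc, ‖z + ε • (P z - x)‖) + b * ∫ z in disc, ‖z + ε • (P z - y)‖ := by
    rw [← integral_const_mul, ← integral_const_mul,
      ← integral_add ((hint x).const_mul a) ((hint y).const_mul b)]
    refine integral_mono (hint _) (((hint x).const_mul a).add ((hint y).const_mul b)) fun z => ?_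
    have : z + ε • (P z - (a • x + b • y)) =
        a • (z + ε • (P z - x)) + b • (z + ε • (P z - y)) := by
      obtain rfl : b = 1 - a := by linarith
      module
    simp only [this]
    refine (norm_add_le _ _).trans_eq ?_
    rw [norm_smul, norm_smul, Real.norm_of_nonneg ha, Real.norm_of_nonneg hb]
  rw [h, h x, h y] at key
  have h2 : 0 < ε ^ 2 := by positivity
  obtain rfl : b = 1 - a := by linarith
  simp only [smul_eq_mul]
  refine le_of_mul_le_mul_left ?_ h2
  linarith

section limit

variable {Q : ℝ → Plane → Plane} {q : Plane → Plane}

lemma eventually_bound_of_tendstoUniformlyOn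
    (hlim : TendstoUniformlyOn Q q (𝓝[>] 0) disc) (hq : Continuous q) :
    ∃ C, 0 ≤ C ∧ ∀ᶠ ε in 𝓝[>] (0 : ℝ), ∀ z ∈ disc, ‖Q ε z‖ ≤ C := by
  obtain ⟨C, hC⟩ := (isCompact_closedBall (0 : Plane) 1).exists_bound_of_continuousOn hq.continuousOn
  have hC0 : 0 ≤ C := (norm_nonneg _).trans (hC 0 (by simp))
  refine ⟨C + 1, by positivity, ?_⟩
  filter_upwards [Metric.tendstoUniformlyOn_iff.1 hlim 1 one_pos] with ε h z hz
  have h1 := h z hz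
  rw [dist_eq_norm, norm_sub_rev] at h1
  calc ‖Q ε z‖ = ‖q z + (Q ε z - q z)‖ := by congr 1; abel
    _ ≤ ‖q z‖ + ‖Q ε z - q z‖ := norm_add_le _ _
    _ ≤ C + 1 := add_le_add (hC z hz) h1.le

lemma setIntegral_box_eq {F : ℝ × ℝ → ℝ} (hF : Continuous F) :
    ∫ p in Set.Ioc (0 : ℝ) 1 ×ˢ Set.Ioo (-Real.pi) Real.pi, F p =
      ∫ θ in (-Real.pi)..Real.pi, ∫ r in (0 : ℝ)..1, F (r, θ) := by
  have hint : IntegrableOn F (Set.Ioc (0 : ℝ) 1 ×ˢ Set.Ioo (-Real.pi) Real.pi) :=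
    (hF.continuousOn.integrableOn_compact (isCompact_Icc.prod isCompact_Icc)).mono_set
      (Set.prod_mono Set.Ioc_subset_Icc_self Set.Ioo_subset_Icc_self)
  rw [IntegrableOn, Measure.volume_eq_prod, ← Measure.prod_restrict] at hint
  rw [Measure.volume_eq_prod, ← Measure.prod_restrict, integral_prod_symm _ hint,
    intervalIntegral.integral_of_le (by linarith [Real.pi_pos]), integral_Ioc_eq_integral_Ioo]
  simp only [intervalIntegral.integral_of_le zero_le_one]

/-- Dominated convergence along the product filter, so that `w` may vary with `ε`; this joint
convergence is what the stability of minimisers requires. -/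
lemma tendsto_l1Energy (hmeas : ∀ᶠ ε in 𝓝[>] (0 : ℝ), Measurable (Q ε))
    (hlim : TendstoUniformlyOn Q q (𝓝[>] 0) disc) (hq : Continuous q) (w : Plane) :
    Tendsto (fun p : ℝ × Plane => l1Energy p.1 (Q p.1) p.2) (𝓝[>] 0 ×ˢ 𝓝 w)
      (𝓝 (∫ z in disc, det2 z (q z - w) ^ 2 / (2 * ‖z‖ ^ 3))) := by
  obtain ⟨C, hC0, hC⟩ := eventually_bound_of_tendstoUniformlyOn hlim hq
  have hpos : ∀ᶠ ε in 𝓝[>] (0 : ℝ), 0 < ε := eventually_mem_nhdsWithin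
  have hw : ∀ᶠ v in 𝓝 w, ‖v‖ ≤ ‖w‖ + 1 :=
    (continuous_norm.tendsto w).eventually_le_const (by linarith)
  have hae : ∀ᵐ z ∂(volume.restrict disc), z ∈ disc ∧ z ≠ 0 := by
    refine (ae_restrict_mem measurableSet_disc).and (ae_restrict_of_ae ?_)
    exact (Measure.ae_ne volume (0 : Plane))
  refine tendsto_integral_filter_of_dominated_convergence
    (fun z => 2 * (C + (‖w‖ + 1)) ^ 2 * ‖z‖⁻¹) ?_ ?_ (integrableOn_inv_norm.const_mul _) ?_
  · filter_upwards [tendsto_fst.eventually hmeas] with p hp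
    unfold normRem
    exact Measurable.aestronglyMeasurable (by fun_prop)
  · filter_upwards [tendsto_fst.eventually hC, tendsto_fst.eventually hpos,
      tendsto_snd.eventually hw] with p h1 h2 h3
    filter_upwards [hae] with z hz
    have h4 : ‖Q p.1 z - p.2‖ ≤ C + (‖w‖ + 1) :=
      (norm_sub_le _ _).trans (add_le_add (h1 z hz.1) h3)
    rw [Real.norm_of_nonneg (div_nonneg (normRem_nonneg _ _) (sq_nonneg _)),
      div_le_iff₀ (by positivity)]
    refine (normRem_le hz.2 _).trans ?_
    rw [norm_smul, Real.norm_of_nonneg h2.le, mul_pow]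
    calc 2 * (p.1 ^ 2 * ‖Q p.1 z - p.2‖ ^ 2) * ‖z‖⁻¹
        = 2 * ‖Q p.1 z - p.2‖ ^ 2 * ‖z‖⁻¹ * p.1 ^ 2 := by ring
      _ ≤ _ := by gcongr
  · filter_upwards [hae] with z hz
    refine tendsto_normRem_div hz.2 ?_ ?_ ?_
    · exact (tendsto_nhdsWithin_iff.1 tendsto_id).1.comp tendsto_fst
    · filter_upwards [tendsto_fst.eventually hpos] with p hp using hp.ne'
    · exact ((hlim.tendsto_at hz.1).comp tendsto_fst).sub tendsto_snd

lemma l1_limit_eq (X M Y w : Plane) :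
    ∫ z in disc, det2 z (quadMap X M Y z - w) ^ 2 / (2 * ‖z‖ ^ 3) =
      (∫ θ in (-Real.pi)..Real.pi, det2 (radial θ) (quadMap X M Y (radial θ)) ^ 2 / 10)
        + Real.pi / 2 * (‖w - medianShift X M Y‖ ^ 2 - ‖medianShift X M Y‖ ^ 2) := by
  have hrad : Continuous radial := by unfold radial; fun_prop
  have hα : Continuous fun θ => det2 (radial θ) (quadMap X M Y (radial θ)) :=
    continuous_det2.comp (hrad.prodMk ((continuous_quadMap X M Y).comp hrad))
  have hβ : Continuous fun θ => det2 (radial θ) w :=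
    continuous_det2.comp (hrad.prodMk continuous_const)
  rw [setIntegral_disc_polar]
  have h1 : ∫ p in Set.Ioc (0 : ℝ) 1 ×ˢ Set.Ioo (-Real.pi) Real.pi,
      p.1 * (det2 (p.1 • radial p.2) (quadMap X M Y (p.1 • radial p.2) - w) ^ 2
        / (2 * ‖p.1 • radial p.2‖ ^ 3)) =
      ∫ p in Set.Ioc (0 : ℝ) 1 ×ˢ Set.Ioo (-Real.pi) Real.pi,
        (p.1 ^ 2 * det2 (radial p.2) (quadMap X M Y (radial p.2)) - det2 (radial p.2) w) ^ 2 / 2 := by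
    refine setIntegral_congr_fun (measurableSet_Ioc.prod measurableSet_Ioo) fun p hp => ?_
    have h0 : 0 < p.1 := hp.1.1
    simp only [quadMap_smul, norm_smul, norm_radial, mul_one, Real.norm_of_nonneg h0.le]
    have : det2 (p.1 • radial p.2) (p.1 ^ 2 • quadMap X M Y (radial p.2) - w) =
        p.1 * (p.1 ^ 2 * det2 (radial p.2) (quadMap X M Y (radial p.2)) - det2 (radial p.2) w) := by
      simp [det2]; ring
    rw [this]
    field_simp
  rw [h1, setIntegral_box_eq (by
    exact (((((continuous_fst.pow 2).mul (hα.comp continuous_snd)).sub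
      (hβ.comp continuous_snd)).pow 2).div_const 2))]
  -- The Jacobian `r` and the factor `r²` from the squared determinant cancel `r³` in the
  -- denominator, so the radial integral is that of a polynomial.
  have h2 : ∀ θ : ℝ, ∫ r in (0 : ℝ)..1, (r ^ 2 * det2 (radial θ) (quadMap X M Y (radial θ))
      - det2 (radial θ) w) ^ 2 / 2 =
      det2 (radial θ) (quadMap X M Y (radial θ)) ^ 2 / 10 + 1 / 2 * (det2 (radial θ) w ^ 2
        - 2 / 3 * (det2 (radial θ) (quadMap X M Y (radial θ)) * det2 (radial θ) w)) := by
    intro θ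
    set α := det2 (radial θ) (quadMap X M Y (radial θ))
    set β := det2 (radial θ) w
    have hd : ∀ r : ℝ, HasDerivAt (fun r : ℝ => r ^ 5 * (α ^ 2 / 10) - r ^ 3 * (α * β / 3)
        + r * (β ^ 2 / 2)) ((r ^ 2 * α - β) ^ 2 / 2) r := by
      intro r
      refine HasDerivAt.congr_deriv ((((hasDerivAt_pow 5 r).mul_const (α ^ 2 / 10)).sub
        ((hasDerivAt_pow 3 r).mul_const (α * β / 3))).add
        ((hasDerivAt_id r).mul_const (β ^ 2 / 2))) ?_
      norm_num; ring
    rw [intervalIntegral.integral_eq_sub_of_hasDerivAt (fun r _ => hd r)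
      ((by fun_prop : Continuous _).intervalIntegrable _ _)]
    ring
  simp only [h2]
  rw [intervalIntegral.integral_add ((by fun_prop : Continuous _).intervalIntegrable _ _)
    ((by fun_prop : Continuous _).intervalIntegrable _ _), intervalIntegral.integral_const_mul,
    integral_det2_radial]
  ring

end limit

/-! ### The remainder of the absolute value. -/

/-- The remainder of the first order expansion of the absolute value at `a`. -/
noncomputable def absRem (a v : ℝ) : ℝ := |a + v| - |a| - a.sign * v

lemma measurable_realSign : Measurable Real.sign := by
  unfold Real.sign
  exact Measurable.ite measurableSet_Iio measurable_const
    (Measurable.ite measurableSet_Ioi measurable_const measurable_const)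

lemma measurable_absRem : Measurable fun p : ℝ × ℝ => absRem p.1 p.2 := by
  have := measurable_realSign
  unfold absRem
  fun_prop

lemma continuous_absRem (a : ℝ) : Continuous (absRem a) := by
  unfold absRem; fun_prop

lemma abs_realSign_le (a : ℝ) : |a.sign| ≤ 1 := by
  rcases Real.sign_apply_eq a with h | h | h <;> rw [h] <;> norm_num

lemma abs_absRem_le (a v : ℝ) : |absRem a v| ≤ 2 * |v| := by
  have h1 : |(|a + v| - |a|)| ≤ |v| := by simpa using abs_abs_sub_abs_le (a + v) a
  have h2 : |a.sign * v| ≤ |v| := by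
    rw [abs_mul]; exact mul_le_of_le_one_left (abs_nonneg v) (abs_realSign_le a)
  calc |absRem a v| ≤ |(|a + v| - |a|)| + |a.sign * v| := abs_sub _ _
    _ ≤ 2 * |v| := by linarith

/-- Without a sign change between `a` and `a + v` the absolute value is linear there. This confines
the Oja integrand to nearly collinear pairs. -/
lemma absRem_eq_zero {a v : ℝ} (h : |v| ≤ |a|) : absRem a v = 0 := by
  rcases lt_trichotomy a 0 with ha | rfl | ha
  · rw [abs_of_neg ha, abs_le] at h
    rw [absRem, Real.sign_of_neg ha, abs_of_neg ha, abs_of_nonpos (by linarith)]; ring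
  · have : v = 0 := by simpa using h
    simp [absRem, this]
  · rw [abs_of_pos ha, abs_le] at h
    rw [absRem, Real.sign_of_pos ha, abs_of_pos ha, abs_of_nonneg (by linarith)]; ring

lemma absRem_mul {c : ℝ} (hc : 0 < c) (a v : ℝ) : absRem (c * a) (c * v) = c * absRem a v := by
  have hs : (c * a).sign = a.sign := by
    rcases lt_trichotomy a 0 with ha | rfl | ha
    · rw [Real.sign_of_neg ha, Real.sign_of_neg (mul_neg_of_pos_of_neg hc ha)]
    · simp
    · rw [Real.sign_of_pos ha, Real.sign_of_pos (mul_pos hc ha)]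
  rw [absRem, absRem, hs, ← mul_add, abs_mul, abs_mul, abs_of_pos hc]; ring

lemma absRem_neg (a v : ℝ) : absRem (-a) (-v) = absRem a v := by
  rw [absRem, absRem, Real.sign_neg, ← neg_add, abs_neg, abs_neg]; ring

/-- For `c ≥ 0` the integrand is almost everywhere a triangle over `(-c, 0]` with base `c` and
height `2 c`. -/
lemma integral_absRem (c : ℝ) : ∫ r, absRem r c = c ^ 2 := by
  have key : ∀ c : ℝ, 0 ≤ c → ∫ r, absRem r c = c ^ 2 := by
    intro c hc
    have h1 : ∀ᵐ r : ℝ, absRem r c = (Set.Ioc (-c) 0).indicator (fun r => 2 * (r + c)) r := by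
      filter_upwards [Measure.ae_ne volume (0 : ℝ)] with r hr
      by_cases hr1 : r ∈ Set.Ioc (-c) 0
      · have hr2 : r < 0 := lt_of_le_of_ne hr1.2 hr
        rw [Set.indicator_of_mem hr1, absRem, Real.sign_of_neg hr2, abs_of_neg hr2,
          abs_of_pos (by linarith [hr1.1])]
        ring
      · rw [Set.indicator_of_notMem hr1]
        rcases lt_or_gt_of_ne hr with h | h
        · have : r ≤ -c := by
            by_contra! h'
            exact hr1 ⟨h', h.le⟩
          exact absRem_eq_zero (by rw [abs_of_nonneg hc, abs_of_neg h]; linarith)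
        · rw [absRem, Real.sign_of_pos h, abs_of_pos h, abs_of_pos (by linarith)]; ring
    rw [integral_congr_ae h1, integral_indicator measurableSet_Ioc,
      ← intervalIntegral.integral_of_le (by linarith)]
    have hd : ∀ r : ℝ, HasDerivAt (fun r : ℝ => (r + c) ^ 2) (2 * (r + c)) r := fun r =>
      HasDerivAt.congr_deriv (((hasDerivAt_id r).add_const c).pow 2) (by simp)
    rw [intervalIntegral.integral_eq_sub_of_hasDerivAt (fun r _ => hd r)
      ((by fun_prop : Continuous _).intervalIntegrable _ _)]
    ring
  rcases le_total 0 c with hc | hc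
  · exact key c hc
  · rw [← neg_sq, ← key (-c) (by linarith), ← integral_neg_eq_self (fun r => absRem r c)]
    refine integral_congr_ae (Eventually.of_forall fun r => ?_)
    simp only
    rw [← absRem_neg, neg_neg]

/-! ### Expansion and convexity of the Oja objective. -/

/-- The deviation of `det2 (z₁ + ε • (P z₁ - w)) (z₂ + ε • (P z₂ - w))` from `det2 z₁ z₂`,
divided by `ε`. -/
def ojaDev (ε : ℝ) (P : Plane → Plane) (w z₁ z₂ : Plane) : ℝ :=
  det2 (P z₁ - w) z₂ + det2 z₁ (P z₂ - w) + ε * det2 (P z₁ - w) (P z₂ - w)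

lemma det2_perturbed (ε : ℝ) (P : Plane → Plane) (w z₁ z₂ : Plane) :
    det2 (z₁ + ε • (P z₁ - w)) (z₂ + ε • (P z₂ - w)) =
      det2 z₁ z₂ + ε * ojaDev ε P w z₁ z₂ := by
  simp [det2, ojaDev]; ring

lemma abs_ojaDev_le {ε : ℝ} (hε : 0 ≤ ε) (hε1 : ε ≤ 1) {P : Plane → Plane} {w z₁ z₂ : Plane}
    {K : ℝ} (h₁ : z₁ ∈ disc) (h₂ : z₂ ∈ disc) (h₃ : ‖P z₁ - w‖ ≤ K) (h₄ : ‖P z₂ - w‖ ≤ K) :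
    |ojaDev ε P w z₁ z₂| ≤ 2 * K + K ^ 2 := by
  have hK : 0 ≤ K := (norm_nonneg _).trans h₃
  have n1 : ‖z₁‖ ≤ 1 := by simpa using h₁
  have n2 : ‖z₂‖ ≤ 1 := by simpa using h₂
  have e1 : |det2 (P z₁ - w) z₂| ≤ K * 1 := (abs_det2_le _ _).trans (by gcongr)
  have e2 : |det2 z₁ (P z₂ - w)| ≤ 1 * K := (abs_det2_le _ _).trans (by gcongr)
  have e3 : |ε * det2 (P z₁ - w) (P z₂ - w)| ≤ 1 * (K * K) := by
    rw [abs_mul, abs_of_nonneg hε]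
    have := (abs_det2_le (P z₁ - w) (P z₂ - w)).trans (by gcongr : _ ≤ K * K)
    gcongr
  calc |ojaDev ε P w z₁ z₂| ≤ _ := (abs_add_le _ _).trans (add_le_add_left (abs_add_le _ _) _)
    _ ≤ 2 * K + K ^ 2 := by linarith

lemma measurable_det2 {α : Type*} [MeasurableSpace α] {f g : α → Plane} (hf : Measurable f)
    (hg : Measurable g) : Measurable fun x => det2 (f x) (g x) :=
  continuous_det2.measurable.comp (hf.prodMk hg)

lemma measurable_ojaDev {α : Type*} [MeasurableSpace α] (ε : ℝ) {P : Plane → Plane}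
    (hP : Measurable P) (w : Plane) {f g : α → Plane} (hf : Measurable f) (hg : Measurable g) :
    Measurable fun x => ojaDev ε P w (f x) (g x) := by
  have h1 : Measurable fun x => P (f x) - w := (hP.comp hf).sub_const w
  have h2 : Measurable fun x => P (g x) - w := (hP.comp hg).sub_const w
  exact ((measurable_det2 h1 hg).add (measurable_det2 hf h2)).add
    ((measurable_det2 h1 h2).const_mul ε)

/-- Lebesgue measure on the unit disc. -/
noncomputable abbrev discMeasure : Measure Plane := volume.restrict disc

lemma integrable_disc_prod_of_bound {F : Plane × Plane → ℝ} (hm : Measurable F) {C : ℝ}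
    (hC : ∀ z₁ ∈ disc, ∀ z₂ ∈ disc, |F (z₁, z₂)| ≤ C) :
    Integrable F (discMeasure.prod discMeasure) := by
  refine Integrable.of_bound hm.aestronglyMeasurable C ?_
  rw [Measure.prod_restrict]
  filter_upwards [ae_restrict_mem (measurableSet_disc.prod measurableSet_disc)] with p hp
  exact hC p.1 hp.1 p.2 hp.2

/-- The rescaled and recentred Oja objective for the data `z + ε • P z`, `z ∈ disc`. -/
noncomputable def ojaEnergy (ε : ℝ) (P : Plane → Plane) (w : Plane) : ℝ :=
  ∫ z₁ in disc, ∫ z₂ in disc, absRem (det2 z₁ z₂) (ε * ojaDev ε P w z₁ z₂) / ε ^ 2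

section expansion

variable {ε : ℝ} {P : Plane → Plane} {C : ℝ}

lemma integrable_abs_det2_perturbed (hε : 0 < ε) (hP : Measurable P)
    (hC : ∀ z ∈ disc, ‖P z‖ ≤ C) (w : Plane) :
    Integrable (fun p : Plane × Plane => |det2 (p.1 + ε • (P p.1 - w)) (p.2 + ε • (P p.2 - w))|)
      (discMeasure.prod discMeasure) := by
  have hb : ∀ z ∈ disc, ‖z + ε • (P z - w)‖ ≤ 1 + ε * (C + ‖w‖) := fun z hz => by
    refine (norm_add_le _ _).trans (add_le_add (by simpa using hz) ?_)
    rw [norm_smul, Real.norm_of_nonneg hε.le]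
    gcongr
    exact (norm_sub_le _ _).trans (by gcongr; exact hC z hz)
  have hm : Measurable fun z => z + ε • (P z - w) := by fun_prop
  refine integrable_disc_prod_of_bound
    (C := (1 + ε * (C + ‖w‖)) * (1 + ε * (C + ‖w‖))) ?_ fun z₁ h₁ z₂ h₂ => ?_
  · exact (measurable_det2 (hm.comp measurable_fst) (hm.comp measurable_snd)).abs
  · rw [abs_abs]
    have := hb z₁ h₁
    have := hb z₂ h₂
    have : 0 ≤ 1 + ε * (C + ‖w‖) := (norm_nonneg _).trans (hb z₁ h₁)
    exact (abs_det2_le _ _).trans (by gcongr)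

/-- Passing from `0` to `w` changes `ojaDev` by `det2 w` of the first data point minus `det2 w` of
the second. Weighted with the sign of `det2 z₁ z₂`, each of these integrates to zero, so no linear
term in `w` survives. -/
lemma integral_abs_det2_eq_ojaEnergy (hε : 0 < ε) (hε1 : ε ≤ 1) (hP : Measurable P)
    (hC : ∀ z ∈ disc, ‖P z‖ ≤ C) (w : Plane) :
    ∫ z₁ in disc, ∫ z₂ in disc, |det2 (z₁ + ε • (P z₁ - w)) (z₂ + ε • (P z₂ - w))| =
      (∫ z₁ in disc, ∫ z₂ in disc,
        (|det2 z₁ z₂| + (det2 z₁ z₂).sign * (ε * ojaDev ε P 0 z₁ z₂)))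
      + ε ^ 2 * ojaEnergy ε P w := by
  set D : Plane × Plane → ℝ := fun p => det2 p.1 p.2 with hD
  have mD : Measurable D := continuous_det2.measurable
  have mS : Measurable fun p => (D p).sign := measurable_realSign.comp mD
  have mJ : ∀ w, Measurable fun p : Plane × Plane => ojaDev ε P w p.1 p.2 := fun w =>
    measurable_ojaDev ε hP w measurable_fst measurable_snd
  have hK : ∀ w, ∀ z ∈ disc, ‖P z - w‖ ≤ C + ‖w‖ := fun w z hz =>
    (norm_sub_le _ _).trans (by gcongr; exact hC z hz)
  have hJ : ∀ w, ∀ z₁ ∈ disc, ∀ z₂ ∈ disc,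
      |ε * ojaDev ε P w z₁ z₂| ≤ ε * (2 * (C + ‖w‖) + (C + ‖w‖) ^ 2) := fun w z₁ h₁ z₂ h₂ => by
    rw [abs_mul, abs_of_pos hε]
    gcongr
    exact abs_ojaDev_le hε.le hε1 h₁ h₂ (hK w z₁ h₁) (hK w z₂ h₂)
  have hsig : ∀ a b c : ℝ, |b| ≤ c → |a.sign * b| ≤ c := fun a b c h => by
    rw [abs_mul]; exact (mul_le_of_le_one_left (abs_nonneg b) (abs_realSign_le a)).trans h
  have iD : Integrable (fun p : Plane × Plane => |D p|) (discMeasure.prod discMeasure) := by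
    refine integrable_disc_prod_of_bound mD.abs (C := 1 * 1) fun z₁ h₁ z₂ h₂ => ?_
    rw [abs_abs]
    have n1 : ‖z₁‖ ≤ 1 := by simpa using h₁
    have n2 : ‖z₂‖ ≤ 1 := by simpa using h₂
    exact (abs_det2_le _ _).trans (by gcongr)
  have iJ : ∀ w, Integrable (fun p : Plane × Plane => (D p).sign * (ε * ojaDev ε P w p.1 p.2))
      (discMeasure.prod discMeasure) := fun w =>
    integrable_disc_prod_of_bound (mS.mul ((mJ w).const_mul ε))
      fun z₁ h₁ z₂ h₂ => hsig _ _ _ (hJ w z₁ h₁ z₂ h₂)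
  have iR : Integrable (fun p : Plane × Plane => absRem (D p) (ε * ojaDev ε P w p.1 p.2))
      (discMeasure.prod discMeasure) :=
    integrable_disc_prod_of_bound (measurable_absRem.comp (mD.prodMk ((mJ w).const_mul ε)))
      fun z₁ h₁ z₂ h₂ => (abs_absRem_le _ _).trans
        (mul_le_mul_of_nonneg_left (hJ w z₁ h₁ z₂ h₂) zero_le_two)
  have hb : ∀ z ∈ disc, ‖z + ε • P z‖ ≤ 1 + ε * C := fun z hz => by
    refine (norm_add_le _ _).trans (add_le_add (by simpa using hz) ?_)
    rw [norm_smul, Real.norm_of_nonneg hε.le]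
    gcongr
    exact hC z hz
  have mP : Measurable fun z => z + ε • P z := by fun_prop
  have i1 : Integrable (fun p : Plane × Plane => (D p).sign * (ε * det2 w (p.1 + ε • P p.1)))
      (discMeasure.prod discMeasure) :=
    integrable_disc_prod_of_bound (mS.mul
      ((measurable_det2 measurable_const (mP.comp measurable_fst)).const_mul ε))
      (C := ε * (‖w‖ * (1 + ε * C))) fun z₁ h₁ z₂ h₂ => hsig _ _ _ (by
        rw [abs_mul, abs_of_pos hε]
        have := hb z₁ h₁
        have := (abs_det2_le w (z₁ + ε • P z₁)).trans (by gcongr : _ ≤ ‖w‖ * (1 + ε * C))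
        gcongr)
  have i2 : Integrable (fun p : Plane × Plane => (D p).sign * (ε * det2 w (p.2 + ε • P p.2)))
      (discMeasure.prod discMeasure) :=
    integrable_disc_prod_of_bound (mS.mul
      ((measurable_det2 measurable_const (mP.comp measurable_snd)).const_mul ε))
      (C := ε * (‖w‖ * (1 + ε * C))) fun z₁ h₁ z₂ h₂ => hsig _ _ _ (by
        rw [abs_mul, abs_of_pos hε]
        have := hb z₂ h₂
        have := (abs_det2_le w (z₂ + ε • P z₂)).trans (by gcongr : _ ≤ ‖w‖ * (1 + ε * C))
        gcongr)
  -- For fixed `z₁` the sign is odd in `z₂` and the other factor does not involve `z₂`; oddness of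
  -- `P` is not needed. The companion integral uses oddness in `z₁`.
  have z1 : ∫ p, (D p).sign * (ε * det2 w (p.1 + ε • P p.1)) ∂(discMeasure.prod discMeasure)
      = 0 := by
    rw [integral_prod _ i1]
    refine integral_eq_zero_of_ae (Eventually.of_forall fun z₁ => ?_)
    refine setIntegral_disc_eq_zero_of_odd fun z => ?_
    have : det2 z₁ (-z) = -det2 z₁ z := by simp [det2]; ring
    simp only [hD, this, Real.sign_neg]; ring
  have z2 : ∫ p, (D p).sign * (ε * det2 w (p.2 + ε • P p.2)) ∂(discMeasure.prod discMeasure)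
      = 0 := by
    rw [integral_prod _ i2]
    refine setIntegral_disc_eq_zero_of_odd fun z => ?_
    rw [← integral_neg]
    refine integral_congr_ae (Eventually.of_forall fun z₂ => ?_)
    have : det2 (-z) z₂ = -det2 z z₂ := by simp [det2]; ring
    simp only [hD, this, Real.sign_neg]; ring
  have hE : ε ^ 2 * ojaEnergy ε P w =
      ∫ z₁ in disc, ∫ z₂ in disc, absRem (det2 z₁ z₂) (ε * ojaDev ε P w z₁ z₂) := by
    simp only [ojaEnergy, integral_div]
    rw [mul_div_cancel₀ _ (pow_ne_zero 2 hε.ne')]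
  have iA : Integrable (fun p : Plane × Plane => |D p| + (D p).sign * (ε * ojaDev ε P 0 p.1 p.2))
      (discMeasure.prod discMeasure) := iD.add (iJ 0)
  have hsplit : ∀ p : Plane × Plane,
      |det2 (p.1 + ε • (P p.1 - w)) (p.2 + ε • (P p.2 - w))| =
      (|D p| + (D p).sign * (ε * ojaDev ε P 0 p.1 p.2))
        + absRem (D p) (ε * ojaDev ε P w p.1 p.2)
        + ((D p).sign * (ε * det2 w (p.1 + ε • P p.1))
          - (D p).sign * (ε * det2 w (p.2 + ε • P p.2))) := fun p => by
    rw [det2_perturbed, absRem]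
    have : ojaDev ε P w p.1 p.2 = ojaDev ε P 0 p.1 p.2
        + (det2 w (p.1 + ε • P p.1) - det2 w (p.2 + ε • P p.2)) := by
      simp [ojaDev, det2]; ring
    rw [this]; ring
  rw [hE, integral_integral (integrable_abs_det2_perturbed hε hP hC w), integral_integral iA,
    integral_integral iR]
  simp only [hsplit]
  have h1 := integral_add (iA.add iR) (i1.sub i2)
  simp only [Pi.add_apply, Pi.sub_apply] at h1
  rw [h1, integral_add iA iR, integral_sub i1 i2, z1, z2]
  simp [hD]

/-- The determinant of two data points recentred at `w` is affine in `w`, its quadratic part being a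
multiple of `det2 w w = 0`; its absolute value is therefore convex. -/
lemma convexOn_ojaEnergy (hε : 0 < ε) (hε1 : ε ≤ 1) (hP : Measurable P)
    (hC : ∀ z ∈ disc, ‖P z‖ ≤ C) : ConvexOn ℝ Set.univ (ojaEnergy ε P) := by
  have hint := integrable_abs_det2_perturbed hε hP hC
  refine ⟨convex_univ, fun x _ y _ a b ha hb hab => ?_⟩
  have h := fun w => integral_abs_det2_eq_ojaEnergy hε hε1 hP hC w
  have key := integral_mono (hint (a • x + b • y))
    (((hint x).const_mul a).add ((hint y).const_mul b)) (fun p => by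
      have : det2 (p.1 + ε • (P p.1 - (a • x + b • y))) (p.2 + ε • (P p.2 - (a • x + b • y))) =
          a * det2 (p.1 + ε • (P p.1 - x)) (p.2 + ε • (P p.2 - x))
          + b * det2 (p.1 + ε • (P p.1 - y)) (p.2 + ε • (P p.2 - y)) := by
        obtain rfl : b = 1 - a := by linarith
        simp [det2]; ring
      simp only [this, Pi.add_apply]
      refine (abs_add_le _ _).trans_eq ?_
      rw [abs_mul, abs_mul, abs_of_nonneg ha, abs_of_nonneg hb])
  have h3 := integral_add ((hint x).const_mul a) ((hint y).const_mul b)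
  simp only [Pi.add_apply] at key
  rw [h3, integral_const_mul, integral_const_mul, integral_prod _ (hint _),
    integral_prod _ (hint x), integral_prod _ (hint y), h, h x, h y] at key
  have h2 : 0 < ε ^ 2 := by positivity
  obtain rfl : b = 1 - a := by linarith
  simp only [smul_eq_mul]
  refine le_of_mul_le_mul_left ?_ h2
  linarith

end expansion

/-! ### The limit of the Oja energy in coordinates adapted to collinear pairs. -/

/-- The parameters of polar coordinates on the unit disc. -/
abbrev polarBox : Set (ℝ × ℝ) := Set.Ioc (0 : ℝ) 1 ×ˢ Set.Ioo (-Real.pi) Real.pi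

lemma measurableSet_polarBox : MeasurableSet polarBox := measurableSet_Ioc.prod measurableSet_Ioo

instance : IsFiniteMeasure (volume.restrict polarBox) := by
  refine ⟨?_⟩
  rw [Measure.restrict_apply_univ, Measure.volume_eq_prod, Measure.prod_prod]
  simp

/-- The point with coordinates `t.1` along `radial p.2` and `ε / p.1 * t.2` along `angular p.2`. -/
noncomputable def framePoint (ε : ℝ) (p t : ℝ × ℝ) : Plane :=
  t.1 • radial p.2 + (ε / p.1 * t.2) • angular p.2

/-- The integrand of the Oja energy in coordinates adapted to the degeneracy of the
determinant. -/
noncomputable def ojaSlice (ε : ℝ) (P : Plane → Plane) (w : Plane) (p t : ℝ × ℝ) : ℝ :=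
  disc.indicator (fun _ => (1 : ℝ)) (framePoint ε p t) *
    absRem t.2 (ojaDev ε P w (p.1 • radial p.2) (framePoint ε p t))

lemma continuous_radial : Continuous radial := by unfold radial; fun_prop

lemma continuous_angular : Continuous angular := by unfold angular; fun_prop

lemma norm_framePoint_sq (ε : ℝ) (p t : ℝ × ℝ) :
    ‖framePoint ε p t‖ ^ 2 = t.1 ^ 2 + (ε / p.1 * t.2) ^ 2 := by
  rw [Plane.norm_sq, framePoint]
  simp only [PiLp.add_apply, PiLp.smul_apply, smul_eq_mul, radial_zero, radial_one, angular_zero,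
    angular_one]
  linear_combination (t.1 ^ 2 + (ε / p.1 * t.2) ^ 2) * Real.sin_sq_add_cos_sq p.2

lemma det2_framePoint {ε : ℝ} {p : ℝ × ℝ} (hp : p.1 ≠ 0) (t : ℝ × ℝ) :
    det2 (p.1 • radial p.2) (framePoint ε p t) = ε * t.2 := by
  have h : det2 (p.1 • radial p.2) (framePoint ε p t) = p.1 * (ε / p.1 * t.2) := by
    simp only [det2, framePoint, PiLp.add_apply, PiLp.smul_apply, smul_eq_mul, radial_zero,
      radial_one, angular_zero, angular_one]
    linear_combination (p.1 * (ε / p.1 * t.2)) * Real.sin_sq_add_cos_sq p.2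
  rw [h]; field_simp

/-- Polar coordinates for `z₁` contribute the Jacobian `r`, the stretched frame for `z₂` contributes
`ε / r`. Together with one `ε` from the homogeneity of `absRem` they cancel the division by `ε²`. -/
lemma ojaEnergy_eq_integral_ojaSlice {ε : ℝ} (hε : 0 < ε) (P : Plane → Plane) (w : Plane) :
    ojaEnergy ε P w = ∫ p in polarBox, ∫ t, ojaSlice ε P w p t := by
  rw [ojaEnergy, setIntegral_disc_polar]
  refine setIntegral_congr_fun measurableSet_polarBox fun p hp => ?_
  have h0 : 0 < p.1 := hp.1.1
  rw [← integral_indicator measurableSet_disc, integral_plane_frame _ p.2 (div_pos hε h0),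
    ← mul_assoc, mul_div_cancel₀ _ h0.ne', ← integral_const_mul]
  refine integral_congr_ae (Eventually.of_forall fun t => ?_)
  change ε * disc.indicator _ (framePoint ε p t) = ojaSlice ε P w p t
  rw [ojaSlice]
  by_cases hz : framePoint ε p t ∈ disc
  · rw [Set.indicator_of_mem hz, Set.indicator_of_mem hz, det2_framePoint h0.ne',
      absRem_mul hε]
    field_simp
  · rw [Set.indicator_of_notMem hz, Set.indicator_of_notMem hz]; simp

lemma measurable_ojaSlice (ε : ℝ) {P : Plane → Plane} (hP : Measurable P) (w : Plane) :
    Measurable fun x : (ℝ × ℝ) × (ℝ × ℝ) => ojaSlice ε P w x.1 x.2 := by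
  have hr := continuous_radial.measurable
  have ha := continuous_angular.measurable
  have hz : Measurable fun x : (ℝ × ℝ) × (ℝ × ℝ) => framePoint ε x.1 x.2 := by
    unfold framePoint; fun_prop
  have hx : Measurable fun x : (ℝ × ℝ) × (ℝ × ℝ) => x.1.1 • radial x.1.2 := by fun_prop
  have hi : Measurable (disc.indicator fun _ => (1 : ℝ)) :=
    measurable_const.indicator measurableSet_disc
  exact (hi.comp hz).mul (measurable_absRem.comp
    ((measurable_snd.comp measurable_snd).prodMk (measurable_ojaDev ε hP w hx hz)))

/-- The dominating function for the Oja integrand. -/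
noncomputable def sliceBound (K : ℝ) (t : ℝ × ℝ) : ℝ :=
  (Set.Icc (-1 : ℝ) 1).indicator (fun _ => (1 : ℝ)) t.1 *
    (Set.Icc (-K) K).indicator (fun _ => 2 * K) t.2

lemma integrable_sliceBound (K : ℝ) : Integrable (sliceBound K) := by
  refine Integrable.mul_prod (f := (Set.Icc (-1 : ℝ) 1).indicator fun _ => (1 : ℝ))
    (g := (Set.Icc (-K) K).indicator fun _ => 2 * K) ?_ ?_
  · exact (integrable_indicator_iff measurableSet_Icc).2 (integrableOn_const (by simp))
  · exact (integrable_indicator_iff measurableSet_Icc).2 (integrableOn_const (by simp))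

lemma abs_absRem_le_sliceBound {K v : ℝ} {t : ℝ × ℝ} (ht : |t.1| ≤ 1) (hv : |v| ≤ K) :
    |absRem t.2 v| ≤ sliceBound K t := by
  rw [sliceBound, Set.indicator_of_mem (show t.1 ∈ Set.Icc (-1 : ℝ) 1 from abs_le.1 ht), one_mul]
  by_cases h : t.2 ∈ Set.Icc (-K) K
  · rw [Set.indicator_of_mem h]
    exact (abs_absRem_le _ _).trans (by linarith)
  · rw [Set.indicator_of_notMem h, absRem_eq_zero, abs_zero]
    have : ¬ |t.2| ≤ K := fun h' => h (abs_le.1 h')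
    linarith

lemma sliceBound_nonneg {K : ℝ} (hK : 0 ≤ K) (t : ℝ × ℝ) : 0 ≤ sliceBound K t :=
  mul_nonneg (Set.indicator_nonneg (fun _ _ => zero_le_one) _)
    (Set.indicator_nonneg (fun _ _ => by positivity) _)

/-- Independent of `ε` and `p`: the disc forces `|t.1| ≤ 1`, and for large `|t.2|` the determinant
keeps its sign. -/
lemma abs_ojaSlice_le {ε : ℝ} (hε : 0 ≤ ε) (hε1 : ε ≤ 1) {P : Plane → Plane} {w : Plane} {K : ℝ}
    (hP : ∀ z ∈ disc, ‖P z - w‖ ≤ K) {p : ℝ × ℝ} (hp : p ∈ polarBox) (t : ℝ × ℝ) :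
    |ojaSlice ε P w p t| ≤ sliceBound (2 * K + K ^ 2) t := by
  have hK : 0 ≤ K := (norm_nonneg _).trans (hP 0 (by simp))
  by_cases hz : framePoint ε p t ∈ disc
  · rw [ojaSlice, Set.indicator_of_mem hz, one_mul]
    have hx : p.1 • radial p.2 ∈ disc := by
      simpa [norm_smul, abs_of_pos hp.1.1] using hp.1.2
    have ht : |t.1| ≤ 1 := by
      have h1 := norm_framePoint_sq ε p t
      have h2 : ‖framePoint ε p t‖ ≤ 1 := by simpa using hz
      rw [← sq_le_one_iff_abs_le_one]
      nlinarith [sq_nonneg (ε / p.1 * t.2), norm_nonneg (framePoint ε p t)]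
    exact abs_absRem_le_sliceBound ht (abs_ojaDev_le hε hε1 hx hz (hP _ hx) (hP _ hz))
  · rw [ojaSlice, Set.indicator_of_notMem hz, zero_mul, abs_zero]
    exact sliceBound_nonneg (by positivity) t

/-- The limit of the deviation of the determinant along collinear pairs of points. -/
noncomputable def sliceDev (X M Y w : Plane) (p : ℝ × ℝ) (s : ℝ) : ℝ :=
  (s - p.1) * (p.1 * s * det2 (radial p.2) (quadMap X M Y (radial p.2)) + det2 (radial p.2) w)

lemma sliceDev_eq (X M Y w : Plane) (p : ℝ × ℝ) (s : ℝ) :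
    det2 (quadMap X M Y (p.1 • radial p.2) - w) (s • radial p.2)
      + det2 (p.1 • radial p.2) (quadMap X M Y (s • radial p.2) - w) = sliceDev X M Y w p s := by
  rw [quadMap_smul, quadMap_smul, sliceDev]
  simp only [det2, PiLp.sub_apply, PiLp.smul_apply, smul_eq_mul]
  ring

lemma continuous_sliceDev (X M Y w : Plane) :
    Continuous fun x : (ℝ × ℝ) × ℝ => sliceDev X M Y w x.1 x.2 := by
  have hα : Continuous fun θ => det2 (radial θ) (quadMap X M Y (radial θ)) :=
    continuous_det2.comp (continuous_radial.prodMk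
      ((continuous_quadMap X M Y).comp continuous_radial))
  have hβ : Continuous fun θ => det2 (radial θ) w :=
    continuous_det2.comp (continuous_radial.prodMk continuous_const)
  have hθ : Continuous fun x : (ℝ × ℝ) × ℝ => x.1.2 := by fun_prop
  have hs : Continuous fun x : (ℝ × ℝ) × ℝ => x.2 - x.1.1 := by fun_prop
  have hm : Continuous fun x : (ℝ × ℝ) × ℝ => x.1.1 * x.2 := by fun_prop
  exact hs.mul ((hm.mul (hα.comp hθ)).add (hβ.comp hθ))

section limit

variable {Q : ℝ → Plane → Plane} {X M Y : Plane}

/-- As `ε → 0` the second point collapses onto the line through the first one. The values `t.1 = ±1`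
are excluded because membership in the disc is not stable there. -/
lemma tendsto_ojaSlice (hlim : TendstoUniformlyOn Q (quadMap X M Y) (𝓝[>] 0) disc) (w : Plane)
    {p : ℝ × ℝ} (hp : p ∈ polarBox) {t : ℝ × ℝ} (ht1 : t.1 ≠ 1) (ht2 : t.1 ≠ -1) :
    Tendsto (fun x : ℝ × Plane => ojaSlice x.1 (Q x.1) x.2 p t) (𝓝[>] 0 ×ˢ 𝓝 w)
      (𝓝 ((Set.Ioo (-1 : ℝ) 1).indicator (fun _ => (1 : ℝ)) t.1
        * absRem t.2 (sliceDev X M Y w p t.1))) := by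
  have hε : Tendsto (fun x : ℝ × Plane => x.1) (𝓝[>] 0 ×ˢ 𝓝 w) (𝓝 0) :=
    (tendsto_nhdsWithin_iff.1 tendsto_id).1.comp tendsto_fst
  have hζ : Tendsto (fun x : ℝ × Plane => framePoint x.1 p t) (𝓝[>] 0 ×ˢ 𝓝 w)
      (𝓝 (t.1 • radial p.2)) := by
    have h : Continuous fun ε : ℝ => framePoint ε p t := by unfold framePoint; fun_prop
    have h0 := (h.tendsto 0).comp hε
    rw [show t.1 • radial p.2 = framePoint 0 p t by simp [framePoint]]
    exact h0
  by_cases hs : t.1 ∈ Set.Ioo (-1 : ℝ) 1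
  · rw [Set.indicator_of_mem hs, one_mul]
    have hmem : t.1 • radial p.2 ∈ Metric.ball (0 : Plane) 1 := by
      simpa [norm_smul] using abs_lt.2 hs
    have hev : ∀ᶠ x : ℝ × Plane in 𝓝[>] 0 ×ˢ 𝓝 w, framePoint x.1 p t ∈ disc :=
      (hζ.eventually (Metric.isOpen_ball.mem_nhds hmem)).mono fun x hx => Metric.ball_subset_closedBall hx
    have hx : p.1 • radial p.2 ∈ disc := by
      simpa [norm_smul, abs_of_pos hp.1.1] using hp.1.2
    have hQ1 : Tendsto (fun x : ℝ × Plane => Q x.1 (p.1 • radial p.2) - x.2) (𝓝[>] 0 ×ˢ 𝓝 w)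
        (𝓝 (quadMap X M Y (p.1 • radial p.2) - w)) :=
      ((hlim.tendsto_at hx).comp tendsto_fst).sub tendsto_snd
    have hQ2 : Tendsto (fun x : ℝ × Plane => Q x.1 (framePoint x.1 p t) - x.2) (𝓝[>] 0 ×ˢ 𝓝 w)
        (𝓝 (quadMap X M Y (t.1 • radial p.2) - w)) := by
      refine Tendsto.sub ?_ tendsto_snd
      -- The argument `framePoint` moves with `ε`, so pointwise convergence would not suffice;
      -- uniform convergence and continuity of the limit do.
      refine tendsto_comp_of_locally_uniform_limit_within (s := disc)
        (continuous_quadMap X M Y).continuousWithinAt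
        (tendsto_nhdsWithin_iff.2 ⟨hζ, hev⟩) fun u hu => ⟨disc, self_mem_nhdsWithin, ?_⟩
      exact tendsto_fst.eventually (hlim u hu)
    have hdet : ∀ {f g : ℝ × Plane → Plane} {a b : Plane},
        Tendsto f (𝓝[>] 0 ×ˢ 𝓝 w) (𝓝 a) → Tendsto g (𝓝[>] 0 ×ˢ 𝓝 w) (𝓝 b) →
        Tendsto (fun x => det2 (f x) (g x)) (𝓝[>] 0 ×ˢ 𝓝 w) (𝓝 (det2 a b)) :=
      fun hf hg => (continuous_det2.tendsto (_, _)).comp (hf.prodMk_nhds hg)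
    have hdev : Tendsto (fun x : ℝ × Plane => ojaDev x.1 (Q x.1) x.2 (p.1 • radial p.2)
        (framePoint x.1 p t)) (𝓝[>] 0 ×ˢ 𝓝 w) (𝓝 (sliceDev X M Y w p t.1)) := by
      have h := ((hdet hQ1 hζ).add (hdet
        (tendsto_const_nhds (x := p.1 • radial p.2)) hQ2)).add (hε.mul (hdet hQ1 hQ2))
      rw [zero_mul, add_zero, sliceDev_eq] at h
      exact h
    refine (((continuous_absRem t.2).tendsto _).comp hdev).congr' ?_
    filter_upwards [hev] with x hx
    simp [ojaSlice, Set.indicator_of_mem hx]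
  · rw [Set.indicator_of_notMem hs, zero_mul]
    refine tendsto_const_nhds.congr fun x => ?_
    have : framePoint x.1 p t ∉ disc := by
      intro hmem
      have h1 := norm_framePoint_sq x.1 p t
      have h2 : ‖framePoint x.1 p t‖ ≤ 1 := by simpa using hmem
      have h3 : |t.1| ≤ 1 := by
        rw [← sq_le_one_iff_abs_le_one]
        nlinarith [sq_nonneg (x.1 / p.1 * t.2), norm_nonneg (framePoint x.1 p t)]
      rw [abs_le] at h3
      exact hs ⟨lt_of_le_of_ne h3.1 (Ne.symm ht2), lt_of_le_of_ne h3.2 ht1⟩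
    simp [ojaSlice, Set.indicator_of_notMem this]

lemma tendsto_ojaEnergy (hmeas : ∀ᶠ ε in 𝓝[>] (0 : ℝ), Measurable (Q ε))
    (hlim : TendstoUniformlyOn Q (quadMap X M Y) (𝓝[>] 0) disc) (w : Plane) :
    Tendsto (fun x : ℝ × Plane => ojaEnergy x.1 (Q x.1) x.2) (𝓝[>] 0 ×ˢ 𝓝 w)
      (𝓝 (∫ p in polarBox, ∫ t : ℝ × ℝ, (Set.Ioo (-1 : ℝ) 1).indicator (fun _ => (1 : ℝ)) t.1
        * absRem t.2 (sliceDev X M Y w p t.1))) := by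
  obtain ⟨C, hC0, hC⟩ := eventually_bound_of_tendstoUniformlyOn hlim (continuous_quadMap X M Y)
  have hpos : ∀ᶠ ε in 𝓝[>] (0 : ℝ), 0 < ε := eventually_mem_nhdsWithin
  have hle : ∀ᶠ ε in 𝓝[>] (0 : ℝ), ε ≤ 1 :=
    (tendsto_nhdsWithin_iff.1 tendsto_id).1.eventually_le_const one_pos
  have hw : ∀ᶠ v in 𝓝 w, ‖v‖ ≤ ‖w‖ + 1 :=
    (continuous_norm.tendsto w).eventually_le_const (by linarith)
  set K := C + (‖w‖ + 1) with hK
  have hbound : ∀ᶠ x : ℝ × Plane in 𝓝[>] 0 ×ˢ 𝓝 w, ∀ p ∈ polarBox, ∀ t,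
      |ojaSlice x.1 (Q x.1) x.2 p t| ≤ sliceBound (2 * K + K ^ 2) t := by
    filter_upwards [tendsto_fst.eventually hC, tendsto_fst.eventually hpos,
      tendsto_fst.eventually hle, tendsto_snd.eventually hw] with x h1 h2 h3 h4 p hp t
    exact abs_ojaSlice_le h2.le h3 (fun z hz => (norm_sub_le _ _).trans
      (add_le_add (h1 z hz) h4)) hp t
  have hae : ∀ᵐ t : ℝ × ℝ, t.1 ≠ 1 ∧ t.1 ≠ -1 :=
    Measure.quasiMeasurePreserving_fst.ae
      ((Measure.ae_ne volume (1 : ℝ)).and (Measure.ae_ne volume (-1 : ℝ)))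
  have hmain : Tendsto (fun x : ℝ × Plane => ∫ p in polarBox, ∫ t, ojaSlice x.1 (Q x.1) x.2 p t)
      (𝓝[>] 0 ×ˢ 𝓝 w) (𝓝 (∫ p in polarBox, ∫ t : ℝ × ℝ,
        (Set.Ioo (-1 : ℝ) 1).indicator (fun _ => (1 : ℝ)) t.1
        * absRem t.2 (sliceDev X M Y w p t.1))) := by
    refine tendsto_integral_filter_of_dominated_convergence
      (fun _ => ∫ t, sliceBound (2 * K + K ^ 2) t) ?_ ?_ (integrable_const _) ?_
    · filter_upwards [tendsto_fst.eventually hmeas] with x hx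
      exact (measurable_ojaSlice x.1 hx x.2).stronglyMeasurable.integral_prod_right.aestronglyMeasurable
    · filter_upwards [hbound] with x hx
      filter_upwards [ae_restrict_mem measurableSet_polarBox] with p hp
      exact norm_integral_le_of_norm_le (integrable_sliceBound _)
        (Eventually.of_forall (hx p hp))
    · filter_upwards [ae_restrict_mem measurableSet_polarBox] with p hp
      refine tendsto_integral_filter_of_dominated_convergence (sliceBound (2 * K + K ^ 2)) ?_ ?_
        (integrable_sliceBound _) ?_
      · filter_upwards [tendsto_fst.eventually hmeas] with x hx
        exact ((measurable_ojaSlice x.1 hx x.2).comp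
          (measurable_const.prodMk measurable_id)).aestronglyMeasurable
      · filter_upwards [hbound] with x hx
        exact Eventually.of_forall (hx p hp)
      · filter_upwards [hae] with t ht
        exact tendsto_ojaSlice hlim w hp ht.1 ht.2
  refine hmain.congr' ?_
  filter_upwards [tendsto_fst.eventually hpos] with x hx
  exact (ojaEnergy_eq_integral_ojaSlice hx _ _).symm

end limit

/-- At fixed `t.1` the deviation does not involve `t.2`, so the transversal integral is
`integral_absRem`. -/
lemma integral_slice_limit (X M Y w : Plane) (p : ℝ × ℝ) :
    ∫ t : ℝ × ℝ, (Set.Ioo (-1 : ℝ) 1).indicator (fun _ => (1 : ℝ)) t.1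
        * absRem t.2 (sliceDev X M Y w p t.1) = ∫ s in (-1 : ℝ)..1, sliceDev X M Y w p s ^ 2 := by
  have hcont : Continuous (sliceDev X M Y w p) :=
    (continuous_sliceDev X M Y w).comp (continuous_const.prodMk continuous_id)
  obtain ⟨K, hK⟩ := (isCompact_Icc (a := (-1 : ℝ)) (b := 1)).exists_bound_of_continuousOn
    hcont.continuousOn
  have hK0 : 0 ≤ K := (norm_nonneg _).trans (hK 0 (by simp))
  have hi : Measurable ((Set.Ioo (-1 : ℝ) 1).indicator fun _ => (1 : ℝ)) :=
    measurable_const.indicator measurableSet_Ioo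
  have hm : Measurable fun t : ℝ × ℝ => (Set.Ioo (-1 : ℝ) 1).indicator (fun _ => (1 : ℝ)) t.1
      * absRem t.2 (sliceDev X M Y w p t.1) :=
    (hi.comp measurable_fst).mul (measurable_absRem.comp
      (measurable_snd.prodMk (hcont.measurable.comp measurable_fst)))
  have hint : Integrable fun t : ℝ × ℝ => (Set.Ioo (-1 : ℝ) 1).indicator (fun _ => (1 : ℝ)) t.1
      * absRem t.2 (sliceDev X M Y w p t.1) := by
    refine (integrable_sliceBound K).mono' hm.aestronglyMeasurable
      (Eventually.of_forall fun t => ?_)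
    by_cases ht : t.1 ∈ Set.Ioo (-1 : ℝ) 1
    · rw [Set.indicator_of_mem ht, one_mul]
      exact abs_absRem_le_sliceBound (abs_lt.2 ht).le (hK _ (Set.Ioo_subset_Icc_self ht))
    · rw [Set.indicator_of_notMem ht, zero_mul, norm_zero]
      exact sliceBound_nonneg hK0 t
  rw [Measure.volume_eq_prod] at hint ⊢
  rw [integral_prod _ hint, intervalIntegral.integral_of_le (by norm_num),
    integral_Ioc_eq_integral_Ioo, ← integral_indicator measurableSet_Ioo]
  refine integral_congr_ae (Eventually.of_forall fun s => ?_)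
  simp only [integral_const_mul, integral_absRem]
  by_cases hs : s ∈ Set.Ioo (-1 : ℝ) 1
  · rw [Set.indicator_of_mem hs, Set.indicator_of_mem hs, one_mul]
  · rw [Set.indicator_of_notMem hs, Set.indicator_of_notMem hs, zero_mul]

lemma integral_sliceDev_sq (X M Y w : Plane) (p : ℝ × ℝ) :
    ∫ s in (-1 : ℝ)..1, sliceDev X M Y w p s ^ 2 =
      2 * (p.1 ^ 2 * det2 (radial p.2) (quadMap X M Y (radial p.2)) ^ 2 / 5
        + (p.1 ^ 4 * det2 (radial p.2) (quadMap X M Y (radial p.2)) ^ 2 + det2 (radial p.2) w ^ 2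
          - 4 * p.1 ^ 2 * (det2 (radial p.2) (quadMap X M Y (radial p.2)) * det2 (radial p.2) w)) / 3
        + p.1 ^ 2 * det2 (radial p.2) w ^ 2) := by
  have hcont : Continuous (sliceDev X M Y w p) :=
    (continuous_sliceDev X M Y w).comp (continuous_const.prodMk continuous_id)
  simp only [sliceDev] at hcont ⊢
  set α := det2 (radial p.2) (quadMap X M Y (radial p.2))
  set β := det2 (radial p.2) w
  set ρ := p.1
  have hd : ∀ s : ℝ, HasDerivAt (fun s : ℝ => s ^ 5 * (ρ ^ 2 * α ^ 2 / 5)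
      + s ^ 4 * ((2 * ρ * α * β - 2 * ρ ^ 3 * α ^ 2) / 4)
      + s ^ 3 * ((β ^ 2 + ρ ^ 4 * α ^ 2 - 4 * ρ ^ 2 * α * β) / 3)
      + s ^ 2 * ((2 * ρ ^ 3 * α * β - 2 * ρ * β ^ 2) / 2)
      + s * (ρ ^ 2 * β ^ 2)) (((s - ρ) * (ρ * s * α + β)) ^ 2) s := by
    intro s
    refine HasDerivAt.congr_deriv ((((((hasDerivAt_pow 5 s).mul_const _).add
      ((hasDerivAt_pow 4 s).mul_const _)).add ((hasDerivAt_pow 3 s).mul_const _)).add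
      ((hasDerivAt_pow 2 s).mul_const _)).add ((hasDerivAt_id s).mul_const _)) ?_
    norm_num; ring
  rw [intervalIntegral.integral_eq_sub_of_hasDerivAt (fun s _ => hd s)
    ((hcont.pow 2).intervalIntegrable _ _)]
  ring

/-- Integrating over both radii leaves the same combination of `α` and `β` as in `l1_limit_eq`, with
another weight and another constant. This agreement is the source of the asymptotic equivalence. -/
lemma oja_limit_eq (X M Y w : Plane) :
    ∫ p in polarBox, ∫ t : ℝ × ℝ, (Set.Ioo (-1 : ℝ) 1).indicator (fun _ => (1 : ℝ)) t.1
        * absRem t.2 (sliceDev X M Y w p t.1) =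
      (∫ θ in (-Real.pi)..Real.pi,
        4 / 15 * det2 (radial θ) (quadMap X M Y (radial θ)) ^ 2)
        + 4 * Real.pi / 3 * (‖w - medianShift X M Y‖ ^ 2 - ‖medianShift X M Y‖ ^ 2) := by
  have hα : Continuous fun θ => det2 (radial θ) (quadMap X M Y (radial θ)) :=
    continuous_det2.comp (continuous_radial.prodMk
      ((continuous_quadMap X M Y).comp continuous_radial))
  have hβ : Continuous fun θ => det2 (radial θ) w :=
    continuous_det2.comp (continuous_radial.prodMk continuous_const)
  simp only [integral_slice_limit, integral_sliceDev_sq]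
  rw [setIntegral_box_eq (by
    have := hα.comp (continuous_snd (X := ℝ))
    have := hβ.comp (continuous_snd (X := ℝ))
    simp only [Function.comp_def] at *
    fun_prop)]
  have h2 : ∀ θ : ℝ, ∫ r in (0 : ℝ)..1,
      2 * (r ^ 2 * det2 (radial θ) (quadMap X M Y (radial θ)) ^ 2 / 5
        + (r ^ 4 * det2 (radial θ) (quadMap X M Y (radial θ)) ^ 2 + det2 (radial θ) w ^ 2
          - 4 * r ^ 2 * (det2 (radial θ) (quadMap X M Y (radial θ)) * det2 (radial θ) w)) / 3
        + r ^ 2 * det2 (radial θ) w ^ 2) =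
      4 / 15 * det2 (radial θ) (quadMap X M Y (radial θ)) ^ 2
        + 4 / 3 * (det2 (radial θ) w ^ 2
          - 2 / 3 * (det2 (radial θ) (quadMap X M Y (radial θ)) * det2 (radial θ) w)) := by
    intro θ
    set α := det2 (radial θ) (quadMap X M Y (radial θ))
    set β := det2 (radial θ) w
    have hd : ∀ r : ℝ, HasDerivAt (fun r : ℝ => r ^ 5 * (2 * α ^ 2 / 15)
        + r ^ 3 * (2 * (α ^ 2 / 5 - 4 * (α * β) / 3 + β ^ 2) / 3) + r * (2 * β ^ 2 / 3))
        (2 * (r ^ 2 * α ^ 2 / 5 + (r ^ 4 * α ^ 2 + β ^ 2 - 4 * r ^ 2 * (α * β)) / 3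
          + r ^ 2 * β ^ 2)) r := by
      intro r
      refine HasDerivAt.congr_deriv ((((hasDerivAt_pow 5 r).mul_const _).add
        ((hasDerivAt_pow 3 r).mul_const _)).add ((hasDerivAt_id r).mul_const _)) ?_
      norm_num; ring
    rw [intervalIntegral.integral_eq_sub_of_hasDerivAt (fun r _ => hd r)
      ((by fun_prop : Continuous _).intervalIntegrable _ _)]
    ring
  simp only [h2]
  rw [intervalIntegral.integral_add ((by fun_prop : Continuous _).intervalIntegrable _ _)
    ((by fun_prop : Continuous _).intervalIntegrable _ _), intervalIntegral.integral_const_mul (4 / 3),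
    integral_det2_radial]
  ring

/-! ### Taylor expansion and rescaling of the data. -/

/-- Second order Taylor expansion at a point. -/
theorem isLittleO_taylor_two {E F : Type*} [NormedAddCommGroup E] [NormedSpace ℝ E]
    [NormedAddCommGroup F] [NormedSpace ℝ F] {f : E → F} {x₀ : E} (hf : ContDiffAt ℝ 2 f x₀) :
    (fun h => f (x₀ + h) - f x₀ - fderiv ℝ f x₀ h
      - (1 / 2 : ℝ) • fderiv ℝ (fderiv ℝ f) x₀ h h) =o[𝓝 0] fun h => ‖h‖ ^ 2 := by
  set A := fderiv ℝ f x₀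
  set B := fderiv ℝ (fderiv ℝ f) x₀ with hB
  -- Symmetry makes `B y` the derivative of `h ↦ (1 / 2) B h h` at `y`.
  have hsymm : ∀ v w, B v w = B w v := fun v w =>
    (hf.isSymmSndFDerivAt (by simp)) v w
  have hd2 : HasFDerivAt (fderiv ℝ f) B x₀ :=
    ((hf.fderiv_right (m := 1) (by norm_num)).differentiableAt (by norm_num)).hasFDerivAt
  have hd1 : ∀ᶠ h in 𝓝 (0 : E), HasFDerivAt f (fderiv ℝ f (x₀ + h)) (x₀ + h) := by
    have h1 : ∀ᶠ x in 𝓝 x₀, DifferentiableAt ℝ f x := by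
      filter_upwards [hf.eventually (by simp)] with x hx
      exact hx.differentiableAt (by norm_num)
    have h2 : Tendsto (fun h : E => x₀ + h) (𝓝 0) (𝓝 x₀) := by
      have h3 : Continuous fun h : E => x₀ + h := by fun_prop
      simpa only [add_zero] using h3.tendsto 0
    exact (h2.eventually h1).mono fun h hh => hh.hasFDerivAt
  rw [isLittleO_iff]
  intro c hc
  have hsmall : ∀ᶠ h in 𝓝 (0 : E), ‖fderiv ℝ f (x₀ + h) - A - B h‖ ≤ c * ‖h‖ :=
    (hasFDerivAt_iff_isLittleO_nhds_zero.1 hd2).def hc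
  obtain ⟨η, hη, hball⟩ := Metric.eventually_nhds_iff_ball.1 (hd1.and hsmall)
  filter_upwards [Metric.ball_mem_nhds (0 : E) hη] with h hh
  have hr : ∀ y ∈ Metric.closedBall (0 : E) ‖h‖, HasFDerivWithinAt
      (fun h => f (x₀ + h) - f x₀ - A h - (1 / 2 : ℝ) • B h h)
      (fderiv ℝ f (x₀ + y) - A - B y) (Metric.closedBall (0 : E) ‖h‖) y := by
    intro y hy
    have hy' : y ∈ Metric.ball (0 : E) η := by
      simp only [mem_closedBall_zero_iff, mem_ball_zero_iff] at *
      exact hy.trans_lt hh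
    have e1 : HasFDerivAt (fun h => f (x₀ + h)) (fderiv ℝ f (x₀ + y)) y := by
      exact (hball y hy').1.comp y ((hasFDerivAt_id y).const_add x₀)
    have e2 : HasFDerivAt (fun h => B h h) (B y + B.flip y) y := by
      have := B.hasFDerivAt (x := y) |>.clm_apply (hasFDerivAt_id y)
      simpa using this
    refine HasFDerivAt.hasFDerivWithinAt ?_
    refine (((e1.sub_const (f x₀)).sub A.hasFDerivAt).sub (e2.const_smul (1 / 2 : ℝ))).congr_fderiv ?_
    ext v
    simp only [sub_apply, smul_apply, add_apply, ContinuousLinearMap.flip_apply, hsymm v y]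
    rw [← two_smul ℝ (B y v), smul_smul]
    norm_num
  have hbd : ∀ y ∈ Metric.closedBall (0 : E) ‖h‖,
      ‖fderiv ℝ f (x₀ + y) - A - B y‖ ≤ c * ‖h‖ := by
    intro y hy
    have hy' : y ∈ Metric.ball (0 : E) η := by
      simp only [mem_closedBall_zero_iff, mem_ball_zero_iff] at *
      exact hy.trans_lt hh
    refine (hball y hy').2.trans ?_
    have : ‖y‖ ≤ ‖h‖ := by simpa using hy
    gcongr
  -- Mean value inequality for the Taylor remainder on the ball of radius `‖h‖`, where its
  -- derivative is at most `c ‖h‖`.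
  have key := (convex_closedBall (0 : E) ‖h‖).norm_image_sub_le_of_norm_hasFDerivWithin_le hr hbd
    (Metric.mem_closedBall_self (norm_nonneg h)) (by simp : h ∈ Metric.closedBall (0 : E) ‖h‖)
  simp only [add_zero, sub_self, map_zero, smul_zero, sub_zero] at key
  rw [Real.norm_of_nonneg (by positivity : 0 ≤ ‖h‖ ^ 2)]
  linarith

/-- The rescaled second order part of `g` at `x₀`, cut off outside the unit disc. -/
noncomputable def secondOrderPart (g : Plane → Plane) (x₀ : Plane) (ε : ℝ) : Plane → Plane :=
  disc.indicator fun z => (ε ^ 2)⁻¹ • (g (x₀ + ε • z) - g x₀ - ε • z)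

lemma eq_add_secondOrderPart (g : Plane → Plane) (x₀ : Plane) {ε : ℝ} (hε : ε ≠ 0) {z : Plane}
    (hz : z ∈ disc) :
    g (x₀ + ε • z) = g x₀ + ε • (z + ε • secondOrderPart g x₀ ε z) := by
  rw [secondOrderPart, Set.indicator_of_mem hz, smul_add, smul_smul, smul_smul,
    show ε * ε * (ε ^ 2)⁻¹ = 1 by field_simp, one_smul]
  abel

/-- The cutoff yields measurability on the whole plane although `g` is controlled only on the closed
ball. -/
lemma measurable_secondOrderPart {g : Plane → Plane} {x₀ : Plane} {ε : ℝ} (hε : 0 < ε)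
    (hg : ContinuousOn g (Metric.closedBall x₀ ε)) : Measurable (secondOrderPart g x₀ ε) := by
  have hmaps : Set.MapsTo (fun z : Plane => x₀ + ε • z) disc (Metric.closedBall x₀ ε) := by
    intro z hz
    rw [mem_closedBall_iff_norm, add_sub_cancel_left, norm_smul, Real.norm_of_nonneg hε.le]
    exact mul_le_of_le_one_right hε.le (by simpa using hz)
  have hc : ContinuousOn (fun z => (ε ^ 2)⁻¹ • (g (x₀ + ε • z) - g x₀ - ε • z)) disc := by
    have h1 : ContinuousOn (fun z : Plane => g (x₀ + ε • z)) disc :=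
      hg.comp (by fun_prop) hmaps
    exact ((h1.sub continuousOn_const).sub
      (continuous_const_smul ε).continuousOn).const_smul (ε ^ 2)⁻¹
  classical
  have := ContinuousOn.measurable_piecewise (g := (0 : Plane → Plane)) hc continuousOn_const
    measurableSet_disc
  rwa [Set.piecewise_eq_indicator] at this

lemma tendstoUniformlyOn_secondOrderPart {g : Plane → Plane} {x₀ X M Y : Plane}
    (hT : (fun h => g (x₀ + h) - g x₀ - h - quadMap X M Y h) =o[𝓝 0] fun h => ‖h‖ ^ 2) :
    TendstoUniformlyOn (secondOrderPart g x₀) (quadMap X M Y) (𝓝[>] 0) disc := by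
  rw [Metric.tendstoUniformlyOn_iff]
  intro δ hδ
  obtain ⟨η, hη, hball⟩ := Metric.eventually_nhds_iff_ball.1 (hT.def (half_pos hδ))
  have hlt : ∀ᶠ ε in 𝓝[>] (0 : ℝ), ε < η :=
    (tendsto_nhdsWithin_iff.1 tendsto_id).1.eventually_lt_const hη
  filter_upwards [hlt, eventually_mem_nhdsWithin] with ε h1 (h2 : 0 < ε) z hz
  have hz1 : ‖z‖ ≤ 1 := by simpa using hz
  have hn : ‖ε • z‖ ≤ ε := by
    rw [norm_smul, Real.norm_of_nonneg h2.le]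
    exact mul_le_of_le_one_right h2.le hz1
  have h3 := hball (ε • z) (by rw [mem_ball_zero_iff]; exact hn.trans_lt h1)
  rw [Real.norm_of_nonneg (sq_nonneg _)] at h3
  have h4 : quadMap X M Y z - secondOrderPart g x₀ ε z =
      -((ε ^ 2)⁻¹ • (g (x₀ + ε • z) - g x₀ - ε • z - quadMap X M Y (ε • z))) := by
    rw [secondOrderPart, Set.indicator_of_mem hz, quadMap_smul, smul_sub _ _ (ε ^ 2 • _),
      smul_smul, inv_mul_cancel₀ (by positivity), one_smul, neg_sub]
  rw [dist_eq_norm, h4, norm_neg, norm_smul, norm_inv, Real.norm_of_nonneg (sq_nonneg ε),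
    inv_mul_lt_iff₀ (by positivity)]
  calc _ ≤ δ / 2 * ‖ε • z‖ ^ 2 := h3
    _ ≤ δ / 2 * ε ^ 2 := by gcongr
    _ < ε ^ 2 * δ := by nlinarith [mul_pos hδ (pow_pos h2 2)]

lemma setIntegral_closedBall_eq (x₀ : Plane) {ε : ℝ} (hε : 0 < ε) (h : Plane → ℝ) :
    ∫ x in Metric.closedBall x₀ ε, h x = ε ^ 2 * ∫ z in disc, h (x₀ + ε • z) := by
  have h1 := Measure.integral_comp_smul_of_nonneg (volume : Measure Plane)
    (fun y => (Metric.closedBall x₀ ε).indicator h (x₀ + y)) ε (hR := hε.le)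
  rw [integral_add_left_eq_self (fun y => (Metric.closedBall x₀ ε).indicator h y) x₀,
    finrank_euclideanSpace_fin, smul_eq_mul, integral_indicator Metric.isClosed_closedBall.measurableSet] at h1
  have h2 : ∫ z, (Metric.closedBall x₀ ε).indicator h (x₀ + ε • z) =
      ∫ z in disc, h (x₀ + ε • z) := by
    rw [← integral_indicator measurableSet_disc]
    refine integral_congr_ae (Eventually.of_forall fun z => ?_)
    have hiff : x₀ + ε • z ∈ Metric.closedBall x₀ ε ↔ z ∈ disc := by
      rw [mem_closedBall_iff_norm, add_sub_cancel_left, norm_smul, Real.norm_of_nonneg hε.le,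
        mem_closedBall_zero_iff]
      exact ⟨fun h => by nlinarith, fun h => mul_le_of_le_one_right hε.le h⟩
    by_cases hz : z ∈ disc
    · simp only [Set.indicator_of_mem hz, Set.indicator_of_mem (hiff.2 hz)]
    · simp only [Set.indicator_of_notMem hz, Set.indicator_of_notMem (fun h => hz (hiff.1 h))]
  rw [h2] at h1
  rw [h1, mul_inv_cancel_left₀ (by positivity)]

/-- Two powers of `ε` are the Jacobian, the third is the scale of the data. -/
lemma integral_norm_sub_eq (g : Plane → Plane) (x₀ : Plane) {ε : ℝ} (hε : 0 < ε) (w : Plane) :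
    ∫ x in Metric.closedBall x₀ ε, ‖(g x₀ + ε ^ 2 • w) - g x‖ =
      ε ^ 3 * ∫ z in disc, ‖z + ε • (secondOrderPart g x₀ ε z - w)‖ := by
  rw [setIntegral_closedBall_eq x₀ hε, pow_succ ε 2, mul_assoc,
    ← integral_const_mul ε]
  refine congrArg (ε ^ 2 * ·) ?_
  refine setIntegral_congr_fun measurableSet_disc fun z (hz : z ∈ disc) => ?_
  change ‖g x₀ + ε ^ 2 • w - g (x₀ + ε • z)‖ = ε * ‖z + ε • (secondOrderPart g x₀ ε z - w)‖
  rw [eq_add_secondOrderPart g x₀ hε.ne' hz, ← norm_neg (g x₀ + ε ^ 2 • w - _)]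
  have : -(g x₀ + ε ^ 2 • w - (g x₀ + ε • (z + ε • secondOrderPart g x₀ ε z))) =
      ε • (z + ε • (secondOrderPart g x₀ ε z - w)) := by module
  rw [this, norm_smul, Real.norm_of_nonneg hε.le]

lemma triangleArea_eq_det2 (a b c : Plane) :
    triangleArea a b c = |det2 (b - a) (c - a)| / 2 := by
  simp [triangleArea, det2]

/-- The two Jacobians give `ε⁴` and the determinant another `ε²`. -/
lemma integral_triangleArea_eq (g : Plane → Plane) (x₀ : Plane) {ε : ℝ} (hε : 0 < ε) (w : Plane) :
    ∫ x₁ in Metric.closedBall x₀ ε, ∫ x₂ in Metric.closedBall x₀ ε,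
        triangleArea (g x₀ + ε ^ 2 • w) (g x₁) (g x₂) =
      ε ^ 6 / 2 * ∫ z₁ in disc, ∫ z₂ in disc,
        |det2 (z₁ + ε • (secondOrderPart g x₀ ε z₁ - w))
          (z₂ + ε • (secondOrderPart g x₀ ε z₂ - w))| := by
  rw [setIntegral_closedBall_eq x₀ hε, ← integral_const_mul, ← integral_const_mul]
  refine setIntegral_congr_fun measurableSet_disc fun z₁ h₁ => ?_
  rw [setIntegral_closedBall_eq x₀ hε, ← mul_assoc, ← integral_const_mul, ← integral_const_mul]
  refine setIntegral_congr_fun measurableSet_disc fun z₂ h₂ => ?_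
  rw [triangleArea_eq_det2, eq_add_secondOrderPart g x₀ hε.ne' h₁,
    eq_add_secondOrderPart g x₀ hε.ne' h₂]
  have h : ∀ z : Plane, g x₀ + ε • (z + ε • secondOrderPart g x₀ ε z) - (g x₀ + ε ^ 2 • w) =
      ε • (z + ε • (secondOrderPart g x₀ ε z - w)) := fun z => by module
  rw [h, h, det2_smul_left, det2_smul_right, abs_mul, abs_mul, abs_of_pos hε]
  ring

/-! ### Asymptotics of the medians and uniqueness of the `L¹` median. -/

/-- Asymptotics of a family of sets that are, after rescaling, the sets of minimisers of convex
functions converging to a quadratic function. -/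
theorem eventually_nonempty_and_norm_sub_le {M : ℝ → Set Plane} {E : ℝ → Plane → ℝ}
    {a w₀ : Plane} {κ c : ℝ} (hκ : 0 < κ)
    (hM : ∀ᶠ ε in 𝓝[>] (0 : ℝ), ∀ w, a + ε ^ 2 • w ∈ M ε ↔ ∀ y, E ε w ≤ E ε y)
    (hconv : ∀ᶠ ε in 𝓝[>] (0 : ℝ), ConvexOn ℝ Set.univ (E ε))
    (hlim : ∀ w, Tendsto (fun x : ℝ × Plane => E x.1 x.2) (𝓝[>] 0 ×ˢ 𝓝 w)
      (𝓝 (c + κ * (‖w - w₀‖ ^ 2 - ‖w₀‖ ^ 2)))) {δ : ℝ} (hδ : 0 < δ) :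
    ∀ᶠ ε in 𝓝[>] (0 : ℝ), (M ε).Nonempty ∧
      ∀ m ∈ M ε, ‖m - (a + ε ^ 2 • w₀)‖ ≤ δ * ε ^ 2 := by
  have hmin : ∀ w, w ≠ w₀ → c + κ * (‖w₀ - w₀‖ ^ 2 - ‖w₀‖ ^ 2) <
      c + κ * (‖w - w₀‖ ^ 2 - ‖w₀‖ ^ 2) := fun w hw => by
    have : 0 < ‖w - w₀‖ := norm_pos_iff.2 (sub_ne_zero.2 hw)
    rw [sub_self, norm_zero]
    gcongr
  filter_upwards [hM, eventually_exists_min_of_convexOn hconv hlim hmin hδ,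
    eventually_mem_nhdsWithin] with ε h1 h2 (h3 : 0 < ε)
  refine ⟨?_, fun m hm => ?_⟩
  · obtain ⟨w, hw⟩ := h2.1
    exact ⟨_, (h1 w).2 hw⟩
  · have hmw : m = a + ε ^ 2 • ((ε ^ 2)⁻¹ • (m - a)) := by
      rw [smul_smul, mul_inv_cancel₀ (by positivity), one_smul]; abel
    set w := (ε ^ 2)⁻¹ • (m - a)
    rw [hmw] at hm ⊢
    have h4 := h2.2 w ((h1 w).1 hm)
    have h5 : a + ε ^ 2 • w - (a + ε ^ 2 • w₀) = ε ^ 2 • (w - w₀) := by module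
    rw [h5, norm_smul, Real.norm_of_nonneg (sq_nonneg ε), mul_comm]
    gcongr

lemma forall_exists_rescaled (a : Plane) {ε : ℝ} (hε : 0 < ε) (y : Plane) :
    ∃ v, y = a + ε ^ 2 • v :=
  ⟨(ε ^ 2)⁻¹ • (y - a), by rw [smul_smul, mul_inv_cancel₀ (by positivity), one_smul]; abel⟩

section medians

variable {g : Plane → Plane} {x₀ X M Y : Plane}

theorem l1Medians_asymptotics
    (hg : ∀ᶠ ε in 𝓝[>] (0 : ℝ), ContinuousOn g (Metric.closedBall x₀ ε))
    (hT : (fun h => g (x₀ + h) - g x₀ - h - quadMap X M Y h) =o[𝓝 0] fun h => ‖h‖ ^ 2)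
    {δ : ℝ} (hδ : 0 < δ) :
    ∀ᶠ ε in 𝓝[>] (0 : ℝ), (l1Medians (Metric.closedBall x₀ ε) g).Nonempty ∧
      ∀ m ∈ l1Medians (Metric.closedBall x₀ ε) g,
        ‖m - (g x₀ + ε ^ 2 • medianShift X M Y)‖ ≤ δ * ε ^ 2 := by
  have hpos : ∀ᶠ ε in 𝓝[>] (0 : ℝ), 0 < ε := eventually_mem_nhdsWithin
  have hmeas : ∀ᶠ ε in 𝓝[>] (0 : ℝ), Measurable (secondOrderPart g x₀ ε) := by
    filter_upwards [hg, hpos] with ε h1 h2 using measurable_secondOrderPart h2 h1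
  have hlim := tendstoUniformlyOn_secondOrderPart hT
  obtain ⟨C, -, hC⟩ := eventually_bound_of_tendstoUniformlyOn hlim (continuous_quadMap X M Y)
  refine eventually_nonempty_and_norm_sub_le
    (E := fun ε => l1Energy ε (secondOrderPart g x₀ ε)) (κ := Real.pi / 2)
    (c := ∫ θ in (-Real.pi)..Real.pi, det2 (radial θ) (quadMap X M Y (radial θ)) ^ 2 / 10)
    (by positivity)
    ?_ ?_ (fun w => ?_) hδ
  -- The objective at `g x₀ + ε² w` is an increasing affine function of the energy at `w`, so
  -- minimisers correspond.
  · filter_upwards [hg, hmeas, hC, hpos] with ε h1 h2 h3 h4 w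
    have hE := fun v => integral_norm_eq_l1Energy h4 h2 h3 v
    have h5 : 0 < ε ^ 3 := by positivity
    have h6 : 0 < ε ^ 2 := by positivity
    refine ⟨fun hw y => ?_, fun hw => ⟨h1.integrableOn_compact (isCompact_closedBall _ _),
      fun y => ?_⟩⟩
    · have := hw.2 (g x₀ + ε ^ 2 • y)
      rw [integral_norm_sub_eq g x₀ h4, integral_norm_sub_eq g x₀ h4, mul_le_mul_iff_right₀ h5,
        hE, hE, add_le_add_iff_left, mul_le_mul_iff_right₀ h6] at this
      exact this
    · obtain ⟨v, rfl⟩ := forall_exists_rescaled (g x₀) h4 y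
      rw [integral_norm_sub_eq g x₀ h4, integral_norm_sub_eq g x₀ h4, mul_le_mul_iff_right₀ h5,
        hE, hE, add_le_add_iff_left, mul_le_mul_iff_right₀ h6]
      exact hw v
  · filter_upwards [hmeas, hC, hpos] with ε h2 h3 h4 using convexOn_l1Energy h4 h2 h3
  · rw [← l1_limit_eq]
    exact tendsto_l1Energy hmeas hlim (continuous_quadMap X M Y) w

theorem ojaMedians_asymptotics
    (hg : ∀ᶠ ε in 𝓝[>] (0 : ℝ), ContinuousOn g (Metric.closedBall x₀ ε))
    (hT : (fun h => g (x₀ + h) - g x₀ - h - quadMap X M Y h) =o[𝓝 0] fun h => ‖h‖ ^ 2)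
    {δ : ℝ} (hδ : 0 < δ) :
    ∀ᶠ ε in 𝓝[>] (0 : ℝ), (ojaMedians (Metric.closedBall x₀ ε) g).Nonempty ∧
      ∀ m ∈ ojaMedians (Metric.closedBall x₀ ε) g,
        ‖m - (g x₀ + ε ^ 2 • medianShift X M Y)‖ ≤ δ * ε ^ 2 := by
  have hpos : ∀ᶠ ε in 𝓝[>] (0 : ℝ), 0 < ε := eventually_mem_nhdsWithin
  have hle : ∀ᶠ ε in 𝓝[>] (0 : ℝ), ε ≤ 1 :=
    (tendsto_nhdsWithin_iff.1 tendsto_id).1.eventually_le_const one_pos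
  have hmeas : ∀ᶠ ε in 𝓝[>] (0 : ℝ), Measurable (secondOrderPart g x₀ ε) := by
    filter_upwards [hg, hpos] with ε h1 h2 using measurable_secondOrderPart h2 h1
  have hlim := tendstoUniformlyOn_secondOrderPart hT
  obtain ⟨C, -, hC⟩ := eventually_bound_of_tendstoUniformlyOn hlim (continuous_quadMap X M Y)
  refine eventually_nonempty_and_norm_sub_le
    (E := fun ε => ojaEnergy ε (secondOrderPart g x₀ ε)) (κ := 4 * Real.pi / 3)
    (c := ∫ θ in (-Real.pi)..Real.pi, 4 / 15 * det2 (radial θ) (quadMap X M Y (radial θ)) ^ 2)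
    (by positivity)
    ?_ ?_ (fun w => ?_) hδ
  · filter_upwards [hg, hmeas, hC, hpos, hle] with ε h1 h2 h3 h4 h7 w
    have hE := fun v => integral_abs_det2_eq_ojaEnergy h4 h7 h2 h3 v
    have h5 : 0 < ε ^ 6 / 2 := by positivity
    have h6 : 0 < ε ^ 2 := by positivity
    refine ⟨fun hw y => ?_, fun hw => ⟨h1.integrableOn_compact (isCompact_closedBall _ _),
      fun y => ?_⟩⟩
    · have := hw.2 (g x₀ + ε ^ 2 • y)
      rw [integral_triangleArea_eq g x₀ h4, integral_triangleArea_eq g x₀ h4,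
        mul_le_mul_iff_right₀ h5, hE, hE, add_le_add_iff_left, mul_le_mul_iff_right₀ h6] at this
      exact this
    · obtain ⟨v, rfl⟩ := forall_exists_rescaled (g x₀) h4 y
      rw [integral_triangleArea_eq g x₀ h4, integral_triangleArea_eq g x₀ h4,
        mul_le_mul_iff_right₀ h5, hE, hE, add_le_add_iff_left, mul_le_mul_iff_right₀ h6]
      exact hw v
  · filter_upwards [hmeas, hC, hpos, hle] with ε h2 h3 h4 h5 using convexOn_ojaEnergy h4 h5 h2 h3
  · rw [← oja_limit_eq]
    exact tendsto_ojaEnergy hmeas hlim w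

/-- Equality in the triangle inequality is equality in Cauchy-Schwarz, and Lagrange's identity then
kills the determinant. -/
lemma det2_eq_zero_of_norm_add {a b : Plane} (h : ‖a + b‖ = ‖a‖ + ‖b‖) : det2 a b = 0 := by
  have h1 := Plane.norm_add_sq a b
  rw [h] at h1
  have h2 : inner ℝ b a = ‖a‖ * ‖b‖ := by linarith
  have h3 : (inner ℝ b a) ^ 2 = ‖a‖ ^ 2 * ‖b‖ ^ 2 := by rw [h2]; ring
  rw [Plane.inner_eq, Plane.norm_sq, Plane.norm_sq] at h3
  rw [← sq_eq_zero_iff, det2]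
  linarith

/-- Data that are not concentrated on a line near `x₀` have at most one `L¹` median. -/
theorem l1Medians_subsingleton {ε : ℝ} (hε : 0 < ε)
    (hg : ContinuousOn g (Metric.closedBall x₀ ε))
    (hg' : HasFDerivAt g (ContinuousLinearMap.id ℝ Plane) x₀) :
    (l1Medians (Metric.closedBall x₀ ε) g).Subsingleton := by
  intro m₁ h₁ m₂ h₂
  set S := Metric.closedBall x₀ ε
  have hci : ∀ y, ContinuousOn (fun x => ‖y - g x‖) S := fun y =>
    (continuousOn_const.sub hg).norm
  have hint : ∀ y, IntegrableOn (fun x => ‖y - g x‖) S := fun y =>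
    (hci y).integrableOn_compact (isCompact_closedBall _ _)
  set m := (1 / 2 : ℝ) • (m₁ + m₂)
  have hle : ∀ x, ‖m - g x‖ ≤ 1 / 2 * (‖m₁ - g x‖ + ‖m₂ - g x‖) := fun x => by
    have : m - g x = (1 / 2 : ℝ) • ((m₁ - g x) + (m₂ - g x)) := by module
    rw [this, norm_smul, Real.norm_of_nonneg (by norm_num)]
    gcongr
    exact norm_add_le _ _
  have hsum : IntegrableOn (fun x => 1 / 2 * (‖m₁ - g x‖ + ‖m₂ - g x‖)) S :=
    ((hint m₁).add (hint m₂)).const_mul _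
  -- The midpoint cannot beat the two medians, so the nonnegative convexity gap integrates to zero;
  -- by continuity it vanishes throughout the open ball.
  have hzero : ∫ x in S, (1 / 2 * (‖m₁ - g x‖ + ‖m₂ - g x‖) - ‖m - g x‖) = 0 := by
    refine le_antisymm ?_ (integral_nonneg fun x => sub_nonneg.2 (hle x))
    rw [integral_sub hsum (hint m), integral_const_mul, integral_add (hint m₁) (hint m₂)]
    linarith [h₁.2 m, h₂.2 m]
  have hae := (integral_eq_zero_iff_of_nonneg (fun x => sub_nonneg.2 (hle x))
    (hsum.sub (hint m))).1 hzero
  have hball : Metric.ball x₀ ε ⊆ S := Metric.ball_subset_closedBall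
  have heq := Measure.eqOn_open_of_ae_eq (ae_restrict_of_ae_restrict_of_subset hball hae)
    Metric.isOpen_ball
    (((continuousOn_const.mul ((hci m₁).add (hci m₂))).sub (hci m)).mono hball)
    continuousOn_const
  have hdet : ∀ x ∈ Metric.ball x₀ ε, det2 (m₁ - g x) (m₂ - g x) = 0 := fun x hx => by
    have h := heq hx
    simp only [Pi.zero_apply] at h
    have h' : m - g x = (1 / 2 : ℝ) • ((m₁ - g x) + (m₂ - g x)) := by module
    rw [h', norm_smul, Real.norm_of_nonneg (by norm_num)] at h
    exact det2_eq_zero_of_norm_add (by linarith)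
  -- A normal to `m₂ - m₁`. The vanishing determinant makes `⟨d, g⟩` constant near `x₀`, and its
  -- derivative there is `⟨d, ·⟩`, hence `d = 0`.
  set d : Plane := !₂[m₂ 1 - m₁ 1, -(m₂ 0 - m₁ 0)] with hd
  have hder := ((innerSL ℝ d).hasFDerivAt (x := g x₀)).comp x₀ hg'
  have hconst : (⇑(innerSL ℝ d) ∘ g) =ᶠ[𝓝 x₀] fun _ => inner ℝ d m₁ := by
    filter_upwards [Metric.ball_mem_nhds x₀ hε] with x hx
    have := hdet x hx
    simp only [Function.comp_apply, innerSL_apply_apply, Plane.inner_eq]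
    simp only [det2, PiLp.sub_apply] at this
    simp [hd]
    linarith
  have hd0 : innerSL ℝ d = 0 := by
    have := hder.unique ((hasFDerivAt_const (inner ℝ d m₁) x₀).congr_of_eventuallyEq hconst)
    simpa using this
  have hd1 : d = 0 := by
    have := congrArg (fun φ => φ d) hd0
    simpa using this
  have e0 : d 0 = 0 := by rw [hd1]; rfl
  have e1 : d 1 = 0 := by rw [hd1]; rfl
  simp only [hd, Matrix.cons_val_zero, Matrix.cons_val_one] at e0 e1
  ext i
  fin_cases i
  · simp at e1 ⊢; linarith
  · simp at e0 ⊢; linarith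

end medians

/-! ### Linear equivariance and identification with the PDE. -/

/-- The `i`-th standard basis vector of the plane. -/
noncomputable abbrev unitVec (i : Fin 2) : Plane := EuclideanSpace.single i 1

lemma Plane.eq_smul_add_smul (z : Plane) : z = z 0 • unitVec 0 + z 1 • unitVec 1 := by
  ext i
  fin_cases i <;> simp

lemma map_apply_eq (L : Plane →L[ℝ] Plane) (z : Plane) (i : Fin 2) :
    L z i = z 0 * L (unitVec 0) i + z 1 * L (unitVec 1) i := by
  conv_lhs => rw [Plane.eq_smul_add_smul z]
  simp

lemma det_eq_det2 (L : Plane →L[ℝ] Plane) : L.det = det2 (L (unitVec 0)) (L (unitVec 1)) := by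
  rw [ContinuousLinearMap.det, ← LinearMap.det_toMatrix (EuclideanSpace.basisFun (Fin 2) ℝ).toBasis,
    Matrix.det_fin_two]
  simp [LinearMap.toMatrix_apply, det2]
  ring

lemma det2_map (L : Plane →L[ℝ] Plane) (a b : Plane) : det2 (L a) (L b) = L.det * det2 a b := by
  rw [det_eq_det2]
  simp only [det2, map_apply_eq L a, map_apply_eq L b]
  ring

lemma triangleArea_map (L : Plane →L[ℝ] Plane) (a b c : Plane) :
    triangleArea (L a) (L b) (L c) = |L.det| * triangleArea a b c := by
  rw [triangleArea_eq_det2, triangleArea_eq_det2, ← map_sub, ← map_sub, det2_map, abs_mul]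
  ring

/-- Affine equivariance of the Oja median, linear case. -/
lemma ojaMedians_eq_image (e : Plane ≃L[ℝ] Plane) (S : Set Plane) (f : Plane → Plane) :
    ojaMedians S f = e '' ojaMedians S fun x => e.symm (f x) := by
  have hdet : 0 < |(e : Plane →L[ℝ] Plane).det| := by
    rw [abs_pos]
    exact (LinearEquiv.isUnit_det' e.toLinearEquiv).ne_zero
  have hJ : ∀ y, ∫ x₁ in S, ∫ x₂ in S, triangleArea (e y) (f x₁) (f x₂) =
      |(e : Plane →L[ℝ] Plane).det| *
        ∫ x₁ in S, ∫ x₂ in S, triangleArea y (e.symm (f x₁)) (e.symm (f x₂)) := by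
    intro y
    rw [← integral_const_mul]
    congr 1 with x₁
    rw [← integral_const_mul]
    congr 1 with x₂
    rw [← triangleArea_map]
    simp
  have hint : IntegrableOn (fun x => e.symm (f x)) S ↔ IntegrableOn f S :=
    ContinuousLinearEquiv.integrable_comp_iff e.symm
  ext m
  constructor
  · rintro ⟨h1, h2⟩
    refine ⟨e.symm m, ⟨hint.2 h1, fun y => ?_⟩, by simp⟩
    have := h2 (e y)
    have hm := hJ (e.symm m)
    rw [e.apply_symm_apply] at hm
    rw [hm, hJ] at this
    exact le_of_mul_le_mul_left this hdet
  · rintro ⟨m, ⟨h1, h2⟩, rfl⟩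
    refine ⟨hint.1 h1, fun y => ?_⟩
    rw [← e.apply_symm_apply y, hJ, hJ]
    exact mul_le_mul_of_nonneg_left (h2 _) hdet.le

section derivatives

variable {u : Plane → Plane} {x₀ : Plane}

lemma pd_component {x : Plane} (hu : DifferentiableAt ℝ u x) (i k : Fin 2) :
    pd i (fun z => u z k) x = fderiv ℝ u x (unitVec i) k := by
  have h := (EuclideanSpace.proj k : Plane →L[ℝ] ℝ).hasFDerivAt.comp x
    hu.hasFDerivAt
  have h' : fderiv ℝ (fun z => u z k) x = _ := h.fderiv
  rw [pd, h']
  rfl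

lemma pd_pd_component (hu : ContDiffAt ℝ 2 u x₀) (i j k : Fin 2) :
    pd j (pd i fun z => u z k) x₀ =
      fderiv ℝ (fderiv ℝ u) x₀ (unitVec j) (unitVec i) k := by
  have hd2 : HasFDerivAt (fderiv ℝ u) (fderiv ℝ (fderiv ℝ u) x₀) x₀ :=
    ((hu.fderiv_right (m := 1) (by norm_num)).differentiableAt (by norm_num)).hasFDerivAt
  have hev : (pd i fun z => u z k) =ᶠ[𝓝 x₀] fun x => fderiv ℝ u x (unitVec i) k := by
    filter_upwards [hu.eventually (by simp)] with x hx
    exact pd_component (hx.differentiableAt (by norm_num)) i k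
  have h1 : HasFDerivAt (fun x => fderiv ℝ u x (unitVec i))
      ((ContinuousLinearMap.apply ℝ Plane (unitVec i)).comp (fderiv ℝ (fderiv ℝ u) x₀)) x₀ :=
    (ContinuousLinearMap.apply ℝ Plane (unitVec i)).hasFDerivAt.comp x₀ hd2
  have h2 := (EuclideanSpace.proj k : Plane →L[ℝ] ℝ).hasFDerivAt.comp x₀ h1
  have h3 : fderiv ℝ (pd i fun z => u z k) x₀ = _ := (h2.congr_of_eventuallyEq hev).fderiv
  rw [pd, h3]
  rfl

lemma half_fderiv_two_eq_quadMap (hu : ContDiffAt ℝ 2 u x₀) (z : Plane) :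
    (1 / 2 : ℝ) • fderiv ℝ (fderiv ℝ u) x₀ z z =
      quadMap (fderiv ℝ (fderiv ℝ u) x₀ (unitVec 0) (unitVec 0))
        (fderiv ℝ (fderiv ℝ u) x₀ (unitVec 1) (unitVec 0))
        (fderiv ℝ (fderiv ℝ u) x₀ (unitVec 1) (unitVec 1)) z := by
  have hsymm : fderiv ℝ (fderiv ℝ u) x₀ (unitVec 0) (unitVec 1) =
      fderiv ℝ (fderiv ℝ u) x₀ (unitVec 1) (unitVec 0) :=
    (hu.isSymmSndFDerivAt (by simp)) _ _
  set B := fderiv ℝ (fderiv ℝ u) x₀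
  have hz : B z z = B (z 0 • unitVec 0 + z 1 • unitVec 1) (z 0 • unitVec 0 + z 1 • unitVec 1) := by
    rw [← Plane.eq_smul_add_smul z]
  rw [hz, quadMap]
  simp only [map_add, map_smul, add_apply, smul_apply, hsymm]
  module

lemma map_quadMap (L : Plane →L[ℝ] Plane) (X M Y z : Plane) :
    L (quadMap X M Y z) = quadMap (L X) (L M) (L Y) z := by
  simp [quadMap]

lemma mulVec_two (a b c d x y : ℝ) :
    !![a, b; c, d] *ᵥ ![x, y] = ![a * x + b * y, c * x + d * y] := by
  ext i
  fin_cases i <;> simp [Matrix.mulVec, dotProduct, Fin.sum_univ_two]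

/-- Here `X`, `M`, `Y` are the second derivatives expressed in the basis of columns of `Du`.
Substituting them leaves `det Du` as the only denominator, and clearing it leaves a polynomial
identity. -/
lemma map_medianShift_eq_pdeRHS (hu : ContDiffAt ℝ 2 u x₀) (hdet : (fderiv ℝ u x₀).det ≠ 0)
    {X M Y : Plane} (hX : fderiv ℝ (fderiv ℝ u) x₀ (unitVec 0) (unitVec 0) = fderiv ℝ u x₀ X)
    (hM : fderiv ℝ (fderiv ℝ u) x₀ (unitVec 1) (unitVec 0) = fderiv ℝ u x₀ M)
    (hY : fderiv ℝ (fderiv ℝ u) x₀ (unitVec 1) (unitVec 1) = fderiv ℝ u x₀ Y) :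
    fderiv ℝ u x₀ (medianShift X M Y) = (1 / 24 : ℝ) • pdeRHS u x₀ := by
  have hd : DifferentiableAt ℝ u x₀ := hu.differentiableAt (by norm_num)
  rw [det_eq_det2, det2] at hdet
  ext k
  simp only [pdeRHS, pd_component hd, pd_pd_component hu, hX, hM, hY]
  set L := fderiv ℝ u x₀
  rw [map_apply_eq]
  simp only [map_apply_eq L X, map_apply_eq L M, map_apply_eq L Y]
  have hne : L (unitVec 0) 0 * L (unitVec 1) 1 - L (unitVec 1) 0 * L (unitVec 0) 1 ≠ 0 := by
    rwa [mul_comm (L (unitVec 1) 0)]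
  fin_cases k
  all_goals
    simp only [medianShift, coeffA, coeffB, Matrix.smul_mulVec, mulVec_two, PiLp.smul_apply,
      Pi.sub_apply, Pi.smul_apply, smul_eq_mul, Matrix.cons_val_zero, Matrix.cons_val_one,
      Fin.zero_eta, Fin.mk_one]
    generalize L (unitVec 0) 0 = ux, L (unitVec 0) 1 = vx, L (unitVec 1) 0 = uy,
      L (unitVec 1) 1 = vy at *
    have hne' : vy * ux - vx * uy ≠ 0 := by rwa [mul_comm vy ux]
    field_simp
    ring

end derivatives

/-! ### Transfer back to the original image and conclusion. -/

/-- Transfer of second order asymptotics through a linear map. -/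
lemma approximatesTimeStep_image (L : Plane →L[ℝ] Plane) {M : ℝ → Set Plane} {a w F : Plane}
    (hF : L w = (1 / 24 : ℝ) • F)
    (hM : ∀ δ : ℝ, 0 < δ → ∀ᶠ ε in 𝓝[>] (0 : ℝ), (M ε).Nonempty ∧
      ∀ m ∈ M ε, ‖m - (a + ε ^ 2 • w)‖ ≤ δ * ε ^ 2) :
    ApproximatesTimeStep (fun ρ => (fun m => L m) '' M ρ) (L a) (fun ρ => ρ ^ 2 / 24) F := by
  refine ⟨(hM 1 one_pos).mono fun ε h => h.1.image _, fun m hm => ?_⟩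
  rw [isLittleO_iff]
  intro c hc
  have hL : 0 < ‖L‖ + 1 := by positivity
  -- The constant absorbs the operator norm and the `24` in the step size; the `+ 1` keeps it
  -- meaningful for `L = 0`.
  filter_upwards [hm, hM (c / (24 * (‖L‖ + 1))) (by positivity)] with ρ h1 h2
  obtain ⟨v, hv, hvm⟩ := h1
  have h3 : m ρ - (L a + (ρ ^ 2 / 24) • F) = L (v - (a + ρ ^ 2 • w)) := by
    rw [map_sub, map_add, map_smul, hF, ← hvm, smul_smul]
    congr 3
    ring
  rw [h3, Real.norm_of_nonneg (by positivity)]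
  calc ‖L (v - (a + ρ ^ 2 • w))‖ ≤ ‖L‖ * ‖v - (a + ρ ^ 2 • w)‖ := L.le_opNorm _
    _ ≤ (‖L‖ + 1) * (c / (24 * (‖L‖ + 1)) * ρ ^ 2) := by
      gcongr
      · linarith
      · exact h2.2 v hv
    _ = c * (ρ ^ 2 / 24) := by field_simp

lemma ApproximatesTimeStep.sub_isLittleO {M N : ℝ → Set Plane} {a F : Plane}
    (hM : ApproximatesTimeStep M a (fun ρ => ρ ^ 2 / 24) F)
    (hN : ApproximatesTimeStep N a (fun ρ => ρ ^ 2 / 24) F) {m o : ℝ → Plane}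
    (hm : ∀ᶠ ρ in 𝓝[>] (0 : ℝ), m ρ ∈ M ρ) (ho : ∀ᶠ ρ in 𝓝[>] (0 : ℝ), o ρ ∈ N ρ) :
    (fun ρ => m ρ - o ρ) =o[𝓝[>] (0 : ℝ)] fun ρ => ρ ^ 2 := by
  have h1 := (hM.2 m hm).sub (hN.2 o ho)
  simp only [sub_sub_sub_cancel_right] at h1
  refine h1.trans_isBigO (IsBigO.of_bound (1 / 24) (Eventually.of_forall fun ρ => ?_))
  rw [norm_div]
  norm_num
  linarith

end BivariateMedian

theorem mainTheorem6 (Ω : Set BivariateMedian.Plane) (hΩ : IsOpen Ω)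
    (u : BivariateMedian.Plane → BivariateMedian.Plane) (hu : ContDiffOn ℝ 2 u Ω)
    (x₀ : BivariateMedian.Plane) (hx₀ : x₀ ∈ Ω) (hdet : (fderiv ℝ u x₀).det ≠ 0) :
    -- the transformed `L¹` median filter is well-defined at `x₀` for all small radii
    (∀ᶠ ρ in 𝓝[>] (0 : ℝ), ∃! w, w ∈ BivariateMedian.transformedL1MedianFilter u x₀ ρ) ∧
    -- it approximates a time step of the PDE system
    BivariateMedian.ApproximatesTimeStep (BivariateMedian.transformedL1MedianFilter u x₀) (u x₀)
      (fun ρ => ρ ^ 2 / 24) (BivariateMedian.pdeRHS u x₀) ∧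
    -- so does the Oja median filter
    BivariateMedian.ApproximatesTimeStep (BivariateMedian.ojaMedianFilter u x₀) (u x₀)
      (fun ρ => ρ ^ 2 / 24) (BivariateMedian.pdeRHS u x₀) ∧
    -- hence the two filters are asymptotically equivalent
    (∀ m o : ℝ → BivariateMedian.Plane,
      (∀ᶠ ρ in 𝓝[>] (0 : ℝ), m ρ ∈ BivariateMedian.transformedL1MedianFilter u x₀ ρ) →
      (∀ᶠ ρ in 𝓝[>] (0 : ℝ), o ρ ∈ BivariateMedian.ojaMedianFilter u x₀ ρ) →
      (fun ρ => m ρ - o ρ) =o[𝓝[>] (0 : ℝ)] (fun ρ => ρ ^ 2)) := by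
  open BivariateMedian in
  have huc : ContDiffAt ℝ 2 u x₀ := hu.contDiffAt (hΩ.mem_nhds hx₀)
  set L := fderiv ℝ u x₀ with hL
  set e := L.toContinuousLinearEquivOfDetNeZero hdet
  have heL : (e : Plane →L[ℝ] Plane) = L :=
    ContinuousLinearMap.coe_toContinuousLinearEquivOfDetNeZero L hdet
  have hea : ∀ z, e z = L z := fun z => by rw [← heL]; rfl
  -- The total function `inverse` is the true inverse here because `det Du(x₀) ≠ 0`.
  have hinv : L.inverse = e.symm := by rw [← heL, ContinuousLinearMap.inverse_equiv]
  set g : Plane → Plane := fun x => e.symm (u x) with hgdef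
  set B := fderiv ℝ (fderiv ℝ u) x₀
  -- Apply `Du(x₀)⁻¹` to the Taylor expansion of `u`; the linear term becomes `h` itself.
  have hT : (fun h => g (x₀ + h) - g x₀ - h - quadMap (e.symm (B (unitVec 0) (unitVec 0)))
      (e.symm (B (unitVec 1) (unitVec 0))) (e.symm (B (unitVec 1) (unitVec 1))) h)
      =o[𝓝 0] fun h => ‖h‖ ^ 2 := by
    refine (((e.symm : Plane →L[ℝ] Plane).isBigO_comp _ _).trans_isLittleO
      (isLittleO_taylor_two huc)).congr_left fun h => ?_
    have h1 := map_quadMap (e.symm : Plane →L[ℝ] Plane) (B (unitVec 0) (unitVec 0))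
      (B (unitVec 1) (unitVec 0)) (B (unitVec 1) (unitVec 1)) h
    rw [half_fderiv_two_eq_quadMap huc, map_sub, map_sub, map_sub, h1, ← hL, ← hea]
    simp [hgdef]
  have hcont : ∀ᶠ ρ in 𝓝[>] (0 : ℝ), ContinuousOn g (Metric.closedBall x₀ ρ) := by
    obtain ⟨r, hr, hball⟩ := Metric.nhds_basis_closedBall.mem_iff.1 (hΩ.mem_nhds hx₀)
    have hle : ∀ᶠ ρ in 𝓝[>] (0 : ℝ), ρ ≤ r :=
      (tendsto_nhdsWithin_iff.1 tendsto_id).1.eventually_le_const hr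
    filter_upwards [hle] with ρ hρ
    exact e.symm.continuous.comp_continuousOn
      (hu.continuousOn.mono ((Metric.closedBall_subset_closedBall hρ).trans hball))
  have hg' : HasFDerivAt g (ContinuousLinearMap.id ℝ Plane) x₀ := by
    have h1 := (e.symm : Plane →L[ℝ] Plane).hasFDerivAt.comp x₀
      (huc.differentiableAt (by norm_num)).hasFDerivAt
    refine h1.congr_fderiv ?_
    ext1 z
    simp [← hL, ← hea]
  have hF := map_medianShift_eq_pdeRHS huc hdet
    (X := e.symm (B (unitVec 0) (unitVec 0))) (M := e.symm (B (unitVec 1) (unitVec 0)))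
    (Y := e.symm (B (unitVec 1) (unitVec 1)))
    (by rw [← hL, ← hea, e.apply_symm_apply]) (by rw [← hL, ← hea, e.apply_symm_apply])
    (by rw [← hL, ← hea, e.apply_symm_apply])
  have hLg : L (g x₀) = u x₀ := by rw [← hea]; simp [hgdef]
  have hl1 : transformedL1MedianFilter u x₀ =
      fun ρ => (fun m => L m) '' l1Medians (Metric.closedBall x₀ ρ) g := by
    funext ρ
    simp only [transformedL1MedianFilter, ← hL, hinv]
    rfl
  have hoja : ojaMedianFilter u x₀ =
      fun ρ => (fun m => L m) '' ojaMedians (Metric.closedBall x₀ ρ) g := by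
    funext ρ
    rw [ojaMedianFilter, ojaMedians_eq_image e]
    simp only [hea, hgdef]
  have hA : ApproximatesTimeStep (transformedL1MedianFilter u x₀) (u x₀)
      (fun ρ => ρ ^ 2 / 24) (pdeRHS u x₀) := by
    rw [hl1, ← hLg]
    exact approximatesTimeStep_image L hF fun δ hδ => l1Medians_asymptotics hcont hT hδ
  have hO : ApproximatesTimeStep (ojaMedianFilter u x₀) (u x₀)
      (fun ρ => ρ ^ 2 / 24) (pdeRHS u x₀) := by
    rw [hoja, ← hLg]
    exact approximatesTimeStep_image L hF fun δ hδ => ojaMedians_asymptotics hcont hT hδ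
  refine ⟨?_, hA, hO, fun m o hm ho => hA.sub_isLittleO hO hm ho⟩
  filter_upwards [hA.1, hcont, eventually_mem_nhdsWithin] with ρ h1 h2 h3
  obtain ⟨w, hw⟩ := h1
  refine ⟨w, hw, fun v hv => ?_⟩
  rw [hl1] at hw hv
  exact (l1Medians_subsingleton h3 h2 hg').image _ hv hw
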